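/- For a set $X$ let $\mathcal D(X)$ be the set of finitely supported probability distributions on $X$, with $\delta_x$ the Dirac distribution at $x$, and let $\mathcal C(X)$ be the set of non-empty convex subsets of $\mathcal D(X)$ that are the convex hull of a finite set. With $\mathcal C(f)$ the direct image under the pushforward of distributions along $f$, unit $x\mapsto\{\delta_x\}$ and multiplication $$\mu^{\mathcal C}_X(S)=\bigcup_{\varphi\in S}\Big\{\textstyle\sum_{i=1}^n p_i\varphi_i \;\Big|\; \varphi_i\in S_i\Big\}\qquad\text{(where } \varphi=\sum_{i=1}^n p_iS_i\in\mathcal D(\mathcal C(X))),$$ $\mathcal C$ is a monad on $\mathbf{Set}$. Let $+\mathbf 1$ be the monad $X\mapsto X+\{\star\}$ on $\mathbf{Set}$. The maps $\gamma_X:\mathcal C(X+\mathbf 1)\to\mathcal C(X)+\mathbf 1$ given by $$\gamma_X(S)=\begin{cases}\{\varphi\in S\mid\varphi(\star)=0\}&\text{if some }\varphi\in S\text{ has }\varphi(\star)=0,\\ \star&\text{otherwise}\end{cases}$$ form a distributive law of the monad $\mathcal C$ over the monad $+\mathbf 1$; let $\mathcal C+\mathbf 1$ denote the resulting composite monad on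 the functor $X\mapsto\mathcal C(X)+\mathbf 1$. Let $\mathtt{Th}^{\bot,BH}_{CS}$ be the equational theory with binary operations $\oplus$ and $+_p$ (one for every $p\in(0,1)$) and a constant $\star$, generated by the following equations, for all $p,q\in(0,1)$: * $x\oplus(y\oplus z)=(x\oplus y)\oplus z$, $\;x\oplus y=y\oplus x$, $\;x\oplus x=x$; * $(x+_qy)+_pz=x+_{pq}(y+_{\frac{p(1-q)}{1-pq}}z)$, $\;x+_py=y+_{1-p}x$, $\;x+_px=x$; * $x+_p(y\oplus z)=(x+_py)\oplus(x+_pz)$; * (bottom) $x\oplus\star=x$; * (black-hole) $x+_p\star=\star$. **Theorem.** The monad $\mathcal C+\mathbf 1$ is presented by $\mathtt{Th}^{\bot,BH}_{CS}$: the category $\mathbf{EM}(\mathcal C+\mathbf 1)$ of Eilenberg–Moore algebras of $\mathcal C+\mathbf 1$ is isomorphic to the category $\mathbf A(\mathtt{Th}^{\bot,BH}_{CS})$ of models of $\mathtt{Th}^{\bot,BH}_{CS}$ and their homomorphisms, by an isomorphism that commutes with the forgetful functors to $\mathbf{Set}$. -/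

import Mathlib

open CategoryTheory

universe u v

namespace ConvexMonad

section MonadTheory

variable {C : Type u} [Category.{v} C]

/-- A distributive law `lam : M N ⟹ N M` of the monad `M` over the monad `N`.
(In Mathlib `F ⋙ G` is "first `F`, then `G`", so the functor `M N` is `N ⋙ M`.) -/
structure DistributiveLaw (M N : CategoryTheory.Monad C) where
  lam : N.toFunctor ⋙ M.toFunctor ⟶ M.toFunctor ⋙ N.toFunctor
  unit_right : ∀ X : C, M.map (N.η.app X) ≫ lam.app X = N.η.app (M.obj X)
  unit_left : ∀ X : C, M.η.app (N.obj X) ≫ lam.app X = N.map (M.η.app X)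
  mul_left : ∀ X : C, M.μ.app (N.obj X) ≫ lam.app X =
    M.map (lam.app X) ≫ lam.app (M.obj X) ≫ N.map (M.μ.app X)
  mul_right : ∀ X : C, M.map (N.μ.app X) ≫ lam.app X =
    lam.app (N.obj X) ≫ N.map (lam.app X) ≫ N.μ.app (M.obj X)

variable {M N : CategoryTheory.Monad C}

theorem DistributiveLaw.naturality (l : DistributiveLaw M N) {X Y : C} (f : X ⟶ Y) :
    M.map (N.map f) ≫ l.lam.app Y = l.lam.app X ≫ N.map (M.map f) :=
  l.lam.naturality f

/-- The composite monad `N M` induced by a distributive law of `M` over `N`: the unit is the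
horizontal composite of the units, the multiplication is
`N M N M ⟹ N N M M ⟹ N M` (apply the law in the middle, then both multiplications). -/
def DistributiveLaw.composite (l : DistributiveLaw M N) : CategoryTheory.Monad C where
  toFunctor := M.toFunctor ⋙ N.toFunctor
  η :=
    { app := fun X => M.η.app X ≫ N.η.app (M.obj X)
      naturality := by
        intro X Y f
        have h1 := CategoryTheory.Monad.unit_naturality C M f
        have h2 := CategoryTheory.Monad.unit_naturality C N (M.map f)
        simp only [Functor.id_map, Functor.comp_map, Category.assoc]
        rw [reassoc_of% h1, h2] }
  μ :=
    { app := fun X => N.map (l.lam.app (M.obj X)) ≫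
        N.map (N.map (M.μ.app X)) ≫ N.μ.app (M.obj X)
      naturality := by
        intro X Y f
        simp only [Functor.comp_map, Category.assoc]
        have h1 := l.naturality (M.map f)
        have h2 := CategoryTheory.Monad.mu_naturality C M f
        have h3 := CategoryTheory.Monad.mu_naturality C N (M.map f)
        have h1' := congrArg (fun t => N.map t) h1
        have h2' := congrArg (fun t => N.map (N.map t)) h2
        simp only [Functor.map_comp] at h1' h2'
        rw [← h3, reassoc_of% h1', reassoc_of% h2'] }
  assoc := by
    intro X
    simp only [Functor.comp_map, Functor.comp_obj]
    have hN := CategoryTheory.Monad.mu_naturality C N (l.lam.app (M.obj X) ≫ N.map (M.μ.app X))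
    have hass := N.assoc (M.obj X)
    have e1' := l.mul_left (M.obj X)
    have e2 := l.mul_right (M.obj X)
    have n1 := l.naturality (l.lam.app (M.obj X))
    have n2 := l.naturality (N.map (M.μ.app X))
    have n3 := l.naturality (M.μ.app X)
    have n5 : N.map (N.map (M.μ.app X)) ≫ N.μ.app (M.obj X) =
        N.μ.app (M.obj (M.obj X)) ≫ N.map (M.μ.app X) :=
      CategoryTheory.Monad.mu_naturality C N (M.μ.app X)
    have a1 := M.assoc X
    have key : M.map (N.map (l.lam.app (M.obj X)) ≫ N.map (N.map (M.μ.app X)) ≫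
          N.μ.app (M.obj X)) ≫ l.lam.app (M.obj X) ≫ N.map (M.μ.app X) =
        l.lam.app (M.obj (N.obj (M.obj X))) ≫ N.map (M.μ.app (N.obj (M.obj X))) ≫
          N.map (l.lam.app (M.obj X) ≫ N.map (M.μ.app X)) ≫ N.μ.app (M.obj X) := by
      simp only [Functor.map_comp, Category.assoc]
      rw [reassoc_of% e2, reassoc_of% n2, reassoc_of% n1, ← n5]
      congr 1
      have f1 := congrArg (fun t => N.map t) e1'
      have f2 := congrArg (fun t => N.map (N.map t)) a1
      have f3 := congrArg (fun t => N.map t) n3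
      simp only [Functor.map_comp, Functor.comp_obj] at f1 f2 f3
      rw [reassoc_of% f1, ← reassoc_of% f2, reassoc_of% f3]
    have key' := congrArg (fun t => N.map t ≫ N.μ.app (M.obj X)) key
    simp only [Functor.map_comp, Category.assoc] at key' hN ⊢
    rw [key', hass, reassoc_of% hN]
  left_unit := by
    intro X
    simp only [Functor.comp_obj, Category.assoc]
    have h := CategoryTheory.Monad.unit_naturality C N (l.lam.app (M.obj X) ≫ N.map (M.μ.app X))
    simp only [Functor.map_comp, Category.assoc] at h
    have h1 := l.unit_left (M.obj X)
    have h2 := M.left_unit X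
    have h3 := N.left_unit (M.obj X)
    rw [← reassoc_of% h, reassoc_of% h1, ← Functor.map_comp_assoc, h2, h3]
    simp
  right_unit := by
    intro X
    simp only [Functor.comp_map, Functor.comp_obj, Functor.map_comp, Category.assoc]
    have h1 := l.unit_right (M.obj X)
    have h2 := M.right_unit X
    have h3 := N.right_unit (M.obj X)
    have h4 := CategoryTheory.Monad.unit_naturality C N (M.μ.app X)
    have h1' := congrArg (fun t => N.map t) h1
    have h4' := congrArg (fun t => N.map t) h4
    have h2' := congrArg (fun t => N.map t) h2
    simp only [Functor.map_comp, Functor.comp_obj] at h1' h4' h2'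
    rw [reassoc_of% h1', ← reassoc_of% h4', h3]
    simpa using h2'

end MonadTheory

section ConvexSets

open scoped Pointwise

/-- `𝒟 X`: the finitely supported probability distributions on `X`, as a subset of the real vector
space `X →₀ ℝ`. -/
def probDist (X : Type u) : Set (X →₀ ℝ) :=
  {φ | (∀ x, 0 ≤ φ x) ∧ (φ.sum fun _ p => p) = 1}

/-- `𝒞 X`: the non-empty finitely generated convex sets of distributions on `X`.  (The finite set
`F` then automatically consists of distributions, and the convexity of `carrier` is automatic.) -/
@[ext]
structure ConvSet (X : Type u) where
  carrier : Set (X →₀ ℝ)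
  subset_dist : carrier ⊆ probDist X
  nonempty : carrier.Nonempty
  finitely_generated : ∃ F : Set (X →₀ ℝ), F.Finite ∧ carrier = convexHull ℝ F

variable {X Y : Type u}

/-- Weighted Minkowski sum: for `φ = ∑ pᵢ Aᵢ`, the set of all `∑ pᵢ φᵢ` with `φᵢ ∈ Aᵢ`.
(As every `A : ConvSet X` is non-empty, choosing `f A ∈ A` for all `A`, or only for those in the
support of `φ`, gives the same sums.) -/
def wms (φ : ConvSet X →₀ ℝ) : Set (X →₀ ℝ) :=
  {z | ∃ f : ConvSet X → (X →₀ ℝ), (∀ A, f A ∈ A.carrier) ∧ z = φ.sum fun A p => p • f A}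

theorem ConvSet.convex (A : ConvSet X) : Convex ℝ A.carrier := by
  obtain ⟨F, -, h⟩ := A.finitely_generated
  rw [h]
  exact convex_convexHull ℝ F

theorem ConvSet.nonneg (A : ConvSet X) {φ : X →₀ ℝ} (h : φ ∈ A.carrier) (x : X) : 0 ≤ φ x :=
  (A.subset_dist h).1 x

theorem ConvSet.exists_choice (A : ConvSet X) {z : X →₀ ℝ} (hz : z ∈ A.carrier) :
    ∃ f : ConvSet X → (X →₀ ℝ), (∀ B, f B ∈ B.carrier) ∧ f A = z := by
  classical
  refine ⟨fun B => if B = A then z else B.nonempty.some, fun B => ?_, by simp⟩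
  by_cases h : B = A
  · subst h
    simpa using hz
  · simpa [h] using B.nonempty.some_mem

theorem mem_wms {φ : ConvSet X →₀ ℝ} {z : X →₀ ℝ} : z ∈ wms φ ↔
    ∃ f : ConvSet X → (X →₀ ℝ), (∀ A, f A ∈ A.carrier) ∧
      z = Finsupp.linearCombination ℝ f φ := by
  simp only [Finsupp.linearCombination_apply]
  rfl

theorem sum_mapDomain (f : X → Y) (φ : X →₀ ℝ) :
    ((Finsupp.mapDomain f φ).sum fun _ p => p) = φ.sum fun _ p => p :=
  Finsupp.sum_mapDomain_index (fun _ => rfl) (fun _ _ _ => rfl)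

theorem mapDomain_nonneg (f : X → Y) {φ : X →₀ ℝ} (h : ∀ x, 0 ≤ φ x) (y : Y) :
    0 ≤ Finsupp.mapDomain f φ y := by
  classical
  rw [Finsupp.mapDomain, Finsupp.sum_apply]
  refine Finset.sum_nonneg fun x _ => ?_
  simp only [Finsupp.single_apply]
  split_ifs
  · exact h x
  · exact le_rfl

theorem mapDomain_mem_dist (f : X → Y) {φ : X →₀ ℝ} (h : φ ∈ probDist X) :
    Finsupp.mapDomain f φ ∈ probDist Y :=
  ⟨mapDomain_nonneg f h.1, by rw [sum_mapDomain]; exact h.2⟩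

theorem convex_dist : Convex ℝ (probDist X) := by
  intro φ hφ ψ hψ a b ha hb hab
  refine ⟨fun x => ?_, ?_⟩
  · have h1 := hφ.1 x
    have h2 := hψ.1 x
    simp only [Finsupp.add_apply, Finsupp.smul_apply, smul_eq_mul]
    positivity
  · have e : ∀ χ : X →₀ ℝ, (χ.sum fun _ p => p) =
        Finsupp.linearCombination ℝ (fun _ => (1 : ℝ)) χ := by
      intro χ
      simp [Finsupp.linearCombination_apply]
    have h1 := hφ.2
    have h2 := hψ.2
    rw [e] at h1 h2 ⊢
    rw [map_add, map_smul, map_smul, h1, h2]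
    simpa using hab

theorem linearCombination_mem {I : Type v} {E : Type u} [AddCommGroup E] [Module ℝ E] {B : Set E}
    (hB : Convex ℝ B) {φ : I →₀ ℝ} (h0 : ∀ i, 0 ≤ φ i) (h1 : (φ.sum fun _ p => p) = 1)
    {f : I → E} (hf : ∀ i, f i ∈ B) : Finsupp.linearCombination ℝ f φ ∈ B := by
  rw [Finsupp.linearCombination_apply]
  exact hB.sum_mem (fun i _ => h0 i) h1 (fun i _ => hf i)

/-- Finitely many nonnegatively weighted choices can be merged into one choice. -/
theorem merge {I J E : Type*} [AddCommGroup E] [Module ℝ E] (B : J → Set E)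
    (hB : ∀ j, Convex ℝ (B j)) (hne : ∀ j, (B j).Nonempty) (s : Finset I) (w : I → J →₀ ℝ)
    (hw : ∀ i ∈ s, ∀ j, 0 ≤ w i j) (f : I → J → E)
    (hf : ∀ i ∈ s, ∀ j, w i j ≠ 0 → f i j ∈ B j) :
    ∃ g : J → E, (∀ j, g j ∈ B j) ∧ Finsupp.linearCombination ℝ g (∑ i ∈ s, w i) =
      ∑ i ∈ s, Finsupp.linearCombination ℝ (f i) (w i) := by
  classical
  have key : ∀ j, ∃ z ∈ B j, (∑ i ∈ s, w i j) • z = ∑ i ∈ s, w i j • f i j := by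
    intro j
    rcases (Finset.sum_nonneg fun i hi => hw i hi j).eq_or_lt with h | h
    · refine ⟨(hne j).some, (hne j).some_mem, ?_⟩
      rw [← h, zero_smul]
      symm
      refine Finset.sum_eq_zero fun i hi => ?_
      rw [(Finset.sum_eq_zero_iff_of_nonneg (fun i hi => hw i hi j)).1 h.symm i hi, zero_smul]
    · have hs : ∑ i ∈ s with w i j ≠ 0, w i j = ∑ i ∈ s, w i j :=
        Finset.sum_filter_ne_zero s
      have hs' : ∑ i ∈ s with w i j ≠ 0, w i j • f i j = ∑ i ∈ s, w i j • f i j := by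
        refine Finset.sum_filter_of_ne fun i _ hne0 h0 => hne0 ?_
        rw [h0, zero_smul]
      refine ⟨(s.filter fun i => w i j ≠ 0).centerMass (fun i => w i j) (fun i => f i j),
        (hB j).centerMass_mem (fun i hi => hw i (Finset.mem_filter.1 hi).1 j) (by rwa [hs])
          (fun i hi => hf i (Finset.mem_filter.1 hi).1 j (Finset.mem_filter.1 hi).2), ?_⟩
      rw [Finset.centerMass, hs, smul_smul, mul_inv_cancel₀ h.ne', one_smul, hs']
  choose g hg hgs using key
  refine ⟨g, hg, ?_⟩
  let T : Finset J := s.biUnion fun i => (w i).support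
  have hT : ∀ i ∈ s, (w i).support ⊆ T := fun i hi =>
    Finset.subset_biUnion_of_mem (fun i => (w i).support) hi
  have hT' : (∑ i ∈ s, w i).support ⊆ T := Finsupp.support_finsetSum
  rw [Finsupp.linearCombination_apply, Finsupp.sum_of_support_subset _ hT' _ (by simp)]
  have e : ∀ i ∈ s, Finsupp.linearCombination ℝ (f i) (w i) = ∑ j ∈ T, w i j • f i j := by
    intro i hi
    rw [Finsupp.linearCombination_apply, Finsupp.sum_of_support_subset _ (hT i hi) _ (by simp)]
  rw [Finset.sum_congr rfl e, Finset.sum_comm]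
  refine Finset.sum_congr rfl fun j _ => ?_
  rw [← hgs j, Finsupp.finsetSum_apply]

theorem merge_fiber {I J E : Type*} [AddCommGroup E] [Module ℝ E] (B : J → Set E)
    (hB : ∀ j, Convex ℝ (B j)) (hne : ∀ j, (B j).Nonempty) (k : I → J) (φ : I →₀ ℝ)
    (hφ : ∀ i, 0 ≤ φ i) (h : I → E) (hh : ∀ i, φ i ≠ 0 → h i ∈ B (k i)) :
    ∃ g : J → E, (∀ j, g j ∈ B j) ∧
      Finsupp.linearCombination ℝ g (Finsupp.mapDomain k φ) =
        Finsupp.linearCombination ℝ h φ := by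
  classical
  obtain ⟨g, hg, e⟩ := merge B hB hne φ.support (fun i => Finsupp.single (k i) (φ i))
    (fun i _ j => by
      rw [Finsupp.single_apply]
      split_ifs
      · exact hφ i
      · exact le_rfl)
    (fun i _ => h i)
    (fun i _ j hj => by
      rw [Finsupp.single_apply] at hj
      split_ifs at hj with hk
      · subst hk
        exact hh i hj
      · exact absurd rfl hj)
  refine ⟨g, hg, ?_⟩
  rw [Finsupp.mapDomain, Finsupp.sum, e, Finsupp.linearCombination_apply, Finsupp.sum]
  simp

/-- `𝒞 f`: the direct image under the pushforward `𝒟 f`. -/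
noncomputable def ConvSet.map (f : X → Y) (A : ConvSet X) : ConvSet Y where
  carrier := Finsupp.mapDomain f '' A.carrier
  subset_dist := by
    rintro _ ⟨φ, hφ, rfl⟩
    exact mapDomain_mem_dist f (A.subset_dist hφ)
  nonempty := A.nonempty.image _
  finitely_generated := by
    obtain ⟨F, hF, h⟩ := A.finitely_generated
    refine ⟨Finsupp.mapDomain f '' F, hF.image _, ?_⟩
    rw [h]
    exact LinearMap.image_convexHull (Finsupp.lmapDomain ℝ ℝ f) F

/-- The unit of `𝒞`: `x ↦ {δ_x}`. -/
noncomputable def ConvSet.unit (x : X) : ConvSet X where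
  carrier := {Finsupp.single x 1}
  subset_dist := by
    classical
    rintro _ rfl
    refine ⟨fun y => ?_, by simp⟩
    rw [Finsupp.single_apply]
    split_ifs <;> norm_num
  nonempty := Set.singleton_nonempty _
  finitely_generated := ⟨{Finsupp.single x 1}, Set.finite_singleton _, by simp⟩

theorem finite_sum_sets {ι E : Type*} [AddCommMonoid E] (s : Finset ι) (t : ι → Set E)
    (h : ∀ i, (t i).Finite) : (∑ i ∈ s, t i).Finite := by
  classical
  induction s using Finset.induction_on with
  | empty => simp
  | insert a s ha ih =>
    rw [Finset.sum_insert ha]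
    exact (h a).add ih

theorem wms_finitely_generated (φ : ConvSet X →₀ ℝ) :
    ∃ F : Set (X →₀ ℝ), F.Finite ∧ wms φ = convexHull ℝ F := by
  classical
  choose B hB hBe using fun A : ConvSet X => A.finitely_generated
  refine ⟨∑ A ∈ φ.support, φ A • B A,
    finite_sum_sets _ _ fun A => (hB A).image _, ?_⟩
  rw [convexHull_sum]
  simp only [convexHull_smul, ← hBe]
  ext z
  rw [Set.mem_finsetSum]
  constructor
  · rintro ⟨f, hf, rfl⟩
    exact ⟨fun A => φ A • f A, fun {A} _ => ⟨f A, hf A, rfl⟩, rfl⟩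
  · rintro ⟨g, hg, rfl⟩
    have : ∀ A : ConvSet X, ∃ y ∈ A.carrier, A ∈ φ.support → φ A • y = g A := by
      intro A
      by_cases hA : A ∈ φ.support
      · obtain ⟨y, hy, e⟩ := hg hA
        exact ⟨y, hy, fun _ => e⟩
      · exact ⟨A.nonempty.some, A.nonempty.some_mem, fun h => absurd h hA⟩
    choose f hf hfe using this
    exact ⟨f, hf, Finset.sum_congr rfl fun A hA => (hfe A hA).symm⟩

/-- The multiplication of `𝒞`: the union of the weighted Minkowski sums of the elements. -/
noncomputable def ConvSet.mult (S : ConvSet (ConvSet X)) : ConvSet X where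
  carrier := ⋃ φ ∈ S.carrier, wms φ
  subset_dist := by
    intro z hz
    simp only [Set.mem_iUnion, mem_wms] at hz
    obtain ⟨φ, hφ, f, hf, rfl⟩ := hz
    exact linearCombination_mem convex_dist (S.subset_dist hφ).1 (S.subset_dist hφ).2
      fun A => A.subset_dist (hf A)
  nonempty := by
    obtain ⟨φ, hφ⟩ := S.nonempty
    refine ⟨φ.sum fun A p => p • A.nonempty.some, ?_⟩
    simp only [Set.mem_iUnion]
    exact ⟨φ, hφ, fun A => A.nonempty.some, fun A => A.nonempty.some_mem, rfl⟩
  finitely_generated := by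
    obtain ⟨F, hF, hS⟩ := S.finitely_generated
    choose G hG hGe using fun φ : ConvSet X →₀ ℝ => wms_finitely_generated φ
    refine ⟨⋃ φ ∈ F, G φ, hF.biUnion fun φ _ => hG φ, Set.Subset.antisymm ?_ ?_⟩
    · intro z hz
      simp only [Set.mem_iUnion, mem_wms] at hz
      obtain ⟨φ, hφ, f, hf, rfl⟩ := hz
      have hsub : S.carrier ⊆ Finsupp.linearCombination ℝ f ⁻¹' convexHull ℝ (⋃ φ ∈ F, G φ) := by
        rw [hS]
        refine convexHull_min ?_ ((convex_convexHull ℝ _).linear_preimage _)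
        intro ψ hψ
        have h1 : Finsupp.linearCombination ℝ f ψ ∈ convexHull ℝ (G ψ) := by
          rw [← hGe, mem_wms]
          exact ⟨f, hf, rfl⟩
        exact convexHull_mono (Set.subset_biUnion_of_mem (u := G) hψ) h1
      exact hsub hφ
    · refine convexHull_min ?_ ?_
      · intro z hz
        simp only [Set.mem_iUnion] at hz ⊢
        obtain ⟨φ, hφ, hz⟩ := hz
        refine ⟨φ, hS ▸ subset_convexHull ℝ F hφ, ?_⟩
        rw [hGe]
        exact subset_convexHull ℝ _ hz
      · intro z₁ h₁ z₂ h₂ a b ha hb hab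
        simp only [Set.mem_iUnion, mem_wms] at h₁ h₂ ⊢
        obtain ⟨φ₁, hφ₁, f₁, hf₁, rfl⟩ := h₁
        obtain ⟨φ₂, hφ₂, f₂, hf₂, rfl⟩ := h₂
        refine ⟨a • φ₁ + b • φ₂, S.convex hφ₁ hφ₂ ha hb hab, ?_⟩
        obtain ⟨g, hg, e⟩ := merge (fun A : ConvSet X => A.carrier) (fun A => A.convex)
          (fun A => A.nonempty) Finset.univ ![a • φ₁, b • φ₂]
          (by
            intro i _ j
            have h1 := S.nonneg hφ₁ j
            have h2 := S.nonneg hφ₂ j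
            fin_cases i
            · simpa using mul_nonneg ha h1
            · simpa using mul_nonneg hb h2)
          ![f₁, f₂]
          (by
            intro i _ j _
            fin_cases i
            · exact hf₁ j
            · exact hf₂ j)
        refine ⟨g, hg, ?_⟩
        simpa [Fin.sum_univ_two] using e.symm

theorem ConvSet.mem_mult {S : ConvSet (ConvSet X)} {z : X →₀ ℝ} : z ∈ S.mult.carrier ↔
    ∃ φ ∈ S.carrier, ∃ f : ConvSet X → (X →₀ ℝ), (∀ A, f A ∈ A.carrier) ∧
      z = Finsupp.linearCombination ℝ f φ := by
  simp only [ConvSet.mult, Set.mem_iUnion, mem_wms, exists_prop]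

theorem ConvSet.mem_map {f : X → Y} {A : ConvSet X} {z : Y →₀ ℝ} : z ∈ (A.map f).carrier ↔
    ∃ φ ∈ A.carrier, Finsupp.mapDomain f φ = z := Iff.rfl

theorem ConvSet.map_id (A : ConvSet X) : A.map id = A := by
  ext z
  simp [ConvSet.mem_map]

theorem ConvSet.map_map {Z : Type u} (f : X → Y) (g : Y → Z) (A : ConvSet X) :
    (A.map f).map g = A.map (g ∘ f) := by
  ext z
  simp [ConvSet.mem_map, Finsupp.mapDomain_comp]

theorem ConvSet.map_unit (f : X → Y) (x : X) :
    (ConvSet.unit x).map f = ConvSet.unit (f x) := by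
  ext z
  simp [ConvSet.map, ConvSet.unit]

theorem ConvSet.map_mult (f : X → Y) (S : ConvSet (ConvSet X)) :
    (S.map (ConvSet.map f)).mult = S.mult.map f := by
  ext z
  rw [ConvSet.mem_mult, ConvSet.mem_map]
  constructor
  · rintro ⟨_, ⟨φ, hφ, rfl⟩, g, hg, rfl⟩
    have : ∀ A : ConvSet X, ∃ y ∈ A.carrier, Finsupp.mapDomain f y = g (A.map f) :=
      fun A => hg (A.map f)
    choose h hh he using this
    refine ⟨_, ConvSet.mem_mult.2 ⟨φ, hφ, h, hh, rfl⟩, ?_⟩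
    rw [Finsupp.linearCombination_mapDomain]
    have := Finsupp.apply_linearCombination ℝ (Finsupp.lmapDomain ℝ ℝ f) h φ
    rw [Finsupp.lmapDomain_apply] at this
    rw [this]
    congr 2
    funext A
    exact he A
  · rintro ⟨_, hz, rfl⟩
    obtain ⟨φ, hφ, h, hh, rfl⟩ := ConvSet.mem_mult.1 hz
    obtain ⟨g, hg, e⟩ := merge_fiber (fun A : ConvSet Y => A.carrier) (fun A => A.convex)
      (fun A => A.nonempty) (ConvSet.map f) φ (S.nonneg hφ)
      (fun A => Finsupp.mapDomain f (h A)) (fun A _ => ⟨h A, hh A, rfl⟩)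
    refine ⟨_, ⟨φ, hφ, rfl⟩, g, hg, ?_⟩
    rw [e]
    exact Finsupp.apply_linearCombination ℝ (Finsupp.lmapDomain ℝ ℝ f) h φ

theorem ConvSet.mult_unit (A : ConvSet X) : (ConvSet.unit A).mult = A := by
  ext z
  rw [ConvSet.mem_mult]
  constructor
  · rintro ⟨_, rfl, f, hf, rfl⟩
    simpa using hf A
  · intro hz
    obtain ⟨f, hf, e⟩ := A.exists_choice hz
    exact ⟨_, rfl, f, hf, by simp [e]⟩

theorem linearCombination_single_one (φ : X →₀ ℝ) :
    Finsupp.linearCombination ℝ (fun x : X => Finsupp.single x (1 : ℝ)) φ = φ := by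
  simp [Finsupp.linearCombination_apply]

theorem ConvSet.mult_map_unit (A : ConvSet X) : (A.map ConvSet.unit).mult = A := by
  ext z
  rw [ConvSet.mem_mult]
  have e : ∀ g : ConvSet X → (X →₀ ℝ), (∀ B, g B ∈ B.carrier) → ∀ φ : X →₀ ℝ,
      Finsupp.linearCombination ℝ g (Finsupp.mapDomain ConvSet.unit φ) = φ := by
    intro g hg φ
    rw [Finsupp.linearCombination_mapDomain]
    have : g ∘ ConvSet.unit = fun x : X => Finsupp.single x (1 : ℝ) := by
      funext x
      exact hg (ConvSet.unit x)
    rw [this, linearCombination_single_one]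
  constructor
  · rintro ⟨_, ⟨φ, hφ, rfl⟩, g, hg, rfl⟩
    rwa [e g hg]
  · intro hz
    exact ⟨_, ⟨z, hz, rfl⟩, fun B => B.nonempty.some, fun B => B.nonempty.some_mem,
      (e _ (fun B => B.nonempty.some_mem) z).symm⟩

theorem ConvSet.mult_map_mult (S : ConvSet (ConvSet (ConvSet X))) :
    (S.map ConvSet.mult).mult = S.mult.mult := by
  ext z
  rw [ConvSet.mem_mult, ConvSet.mem_mult]
  constructor
  · rintro ⟨_, ⟨ψ, hψ, rfl⟩, g, hg, rfl⟩
    have : ∀ B : ConvSet (ConvSet X), ∃ φ ∈ B.carrier, ∃ f : ConvSet X → (X →₀ ℝ),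
        (∀ A, f A ∈ A.carrier) ∧ g B.mult = Finsupp.linearCombination ℝ f φ :=
      fun B => ConvSet.mem_mult.1 (hg B.mult)
    choose p hp f hf e using this
    refine ⟨_, ConvSet.mem_mult.2 ⟨ψ, hψ, p, hp, rfl⟩, ?_⟩
    obtain ⟨h, hh, eh⟩ := merge (fun A : ConvSet X => A.carrier) (fun A => A.convex)
      (fun A => A.nonempty) ψ.support (fun B => ψ B • p B)
      (fun B _ A => mul_nonneg (S.nonneg hψ B) (B.nonneg (hp B) A)) f (fun B _ A _ => hf B A)
    refine ⟨h, hh, ?_⟩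
    rw [Finsupp.linearCombination_mapDomain, Finsupp.linearCombination_apply ℝ (v := p),
      Finsupp.sum, eh, Finsupp.linearCombination_apply, Finsupp.sum]
    refine Finset.sum_congr rfl fun B _ => ?_
    rw [map_smul, ← e B]
    rfl
  · rintro ⟨_, hφ, f, hf, rfl⟩
    obtain ⟨ψ, hψ, p, hp, rfl⟩ := ConvSet.mem_mult.1 hφ
    obtain ⟨g, hg, e⟩ := merge_fiber (fun A : ConvSet X => A.carrier) (fun A => A.convex)
      (fun A => A.nonempty) ConvSet.mult ψ (S.nonneg hψ)
      (fun B => Finsupp.linearCombination ℝ f (p B))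
      (fun B _ => ConvSet.mem_mult.2 ⟨p B, hp B, f, hf, rfl⟩)
    refine ⟨_, ⟨ψ, hψ, rfl⟩, g, hg, ?_⟩
    rw [e]
    exact Finsupp.apply_linearCombination ℝ (Finsupp.linearCombination ℝ f) p ψ

/-- The `Set` monad `𝒞` of non-empty finitely generated convex sets of distributions. -/
noncomputable def convMonad : CategoryTheory.Monad (Type u) where
  obj X := ConvSet X
  map f := ↾(ConvSet.map f)
  map_id X := by
    refine ConcreteCategory.hom_ext _ _ fun A => ?_
    exact ConvSet.map_id A
  map_comp f g := by
    refine ConcreteCategory.hom_ext _ _ fun A => ?_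
    exact (ConvSet.map_map f g A).symm
  η :=
    { app := fun _ => ↾ConvSet.unit
      naturality := by
        intro X Y f
        refine ConcreteCategory.hom_ext _ _ fun x => ?_
        exact (ConvSet.map_unit f x).symm }
  μ :=
    { app := fun _ => ↾ConvSet.mult
      naturality := by
        intro X Y f
        refine ConcreteCategory.hom_ext _ _ fun S => ?_
        exact ConvSet.map_mult f S }
  assoc X := by
    refine ConcreteCategory.hom_ext _ _ fun S => ?_
    exact ConvSet.mult_map_mult S
  left_unit X := by
    refine ConcreteCategory.hom_ext _ _ fun A => ?_
    exact ConvSet.mult_unit A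
  right_unit X := by
    refine ConcreteCategory.hom_ext _ _ fun A => ?_
    exact ConvSet.mult_map_unit A

end ConvexSets

section Gamma

variable {X Y : Type u}

theorem eq_mapDomain_some {φ : Option X →₀ ℝ} (h : φ none = 0) :
    Finsupp.mapDomain some φ.some = φ := by
  ext o
  cases o with
  | none =>
    rw [h, Finsupp.mapDomain_of_notMem_range]
    simp
  | some x => rw [Finsupp.mapDomain_apply (Option.some_injective X), Finsupp.some_apply]

theorem mapDomain_some_none (ψ : X →₀ ℝ) :
    (Finsupp.mapDomain some ψ : Option X →₀ ℝ) none = 0 := by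
  rw [Finsupp.mapDomain_of_notMem_range]
  simp

theorem some_mapDomain_some (ψ : X →₀ ℝ) :
    (Finsupp.mapDomain some ψ : Option X →₀ ℝ).some = ψ := by
  ext x
  rw [Finsupp.some_apply, Finsupp.mapDomain_apply (Option.some_injective X)]

/-- Restriction of finitely supported functions from `X + 1` to `X`, as a linear map. -/
noncomputable def restrict (X : Type u) : (Option X →₀ ℝ) →ₗ[ℝ] (X →₀ ℝ) where
  toFun φ := φ.some
  map_add' φ ψ := Finsupp.some_add φ ψ
  map_smul' c φ := by
    ext x
    simp

theorem convexHull_face (F : Set (Option X →₀ ℝ)) (h0 : ∀ φ ∈ F, 0 ≤ φ none) :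
    {φ | φ ∈ convexHull ℝ F ∧ φ none = 0} = convexHull ℝ {φ | φ ∈ F ∧ φ none = 0} := by
  refine Set.Subset.antisymm ?_ ?_
  · have hsub : convexHull ℝ F ⊆
        {φ | 0 ≤ φ none ∧ (φ none = 0 → φ ∈ convexHull ℝ {φ | φ ∈ F ∧ φ none = 0})} := by
      refine convexHull_min (fun φ hφ => ⟨h0 φ hφ, fun h => subset_convexHull ℝ _ ⟨hφ, h⟩⟩) ?_
      intro φ hφ ψ hψ a b ha hb hab
      have h1 := mul_nonneg ha hφ.1
      have h2 := mul_nonneg hb hψ.1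
      refine ⟨by simpa using add_nonneg h1 h2, fun h => ?_⟩
      have h' : a * φ none + b * ψ none = 0 := by simpa using h
      have e1 : a * φ none = 0 := by linarith
      have e2 : b * ψ none = 0 := by linarith
      rcases mul_eq_zero.1 e1 with ea | ea
      · have eb : b = 1 := by linarith
        subst ea eb
        simp only [one_mul] at e2
        simpa using hψ.2 e2
      · rcases mul_eq_zero.1 e2 with eb | eb
        · have eb' : a = 1 := by linarith
          subst eb eb'
          simpa using hφ.2 ea
        · exact convex_convexHull ℝ _ (hφ.2 ea) (hψ.2 eb) ha hb hab
    exact fun φ hφ => (hsub hφ.1).2 hφ.2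
  · refine convexHull_min (fun φ hφ => ⟨subset_convexHull ℝ _ hφ.1, hφ.2⟩) ?_
    intro φ hφ ψ hψ a b ha hb hab
    refine ⟨convex_convexHull ℝ _ hφ.1 hψ.1 ha hb hab, ?_⟩
    simp [hφ.2, hψ.2]

/-- The set of the `φ ∈ S` with `φ(⋆) = 0`, seen as distributions on `X`, provided there is one. -/
noncomputable def ConvSet.full (S : ConvSet (Option X)) (h : ∃ φ ∈ S.carrier, φ none = 0) :
    ConvSet X where
  carrier := Finsupp.some '' {φ | φ ∈ S.carrier ∧ φ none = 0}
  subset_dist := by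
    rintro _ ⟨φ, ⟨hφ, h0⟩, rfl⟩
    have h1 := S.subset_dist hφ
    refine ⟨fun x => h1.1 (some x), ?_⟩
    rw [← sum_mapDomain some, eq_mapDomain_some h0]
    exact h1.2
  nonempty := by
    obtain ⟨φ, hφ, h0⟩ := h
    exact ⟨φ.some, φ, ⟨hφ, h0⟩, rfl⟩
  finitely_generated := by
    obtain ⟨F, hF, hS⟩ := S.finitely_generated
    refine ⟨Finsupp.some '' {φ | φ ∈ F ∧ φ none = 0}, (hF.subset fun φ h => h.1).image _, ?_⟩
    have h0 : ∀ φ ∈ F, 0 ≤ φ none := fun φ hφ =>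
      S.nonneg (by rw [hS]; exact subset_convexHull ℝ F hφ) none
    rw [hS, convexHull_face F h0]
    exact LinearMap.image_convexHull (restrict X) _

open Classical in
/-- `γ : 𝒞 (X + 1) → 𝒞 X + 1`, sending `S` to the set of its full distributions if there is one,
and to `⋆` otherwise. -/
noncomputable def gammaFun (S : ConvSet (Option X)) : Option (ConvSet X) :=
  if h : ∃ φ ∈ S.carrier, φ none = 0 then some (S.full h) else none

/-- Membership in an element of `𝒞 X + 1`, where `⋆` is seen as the empty set. -/
def MemOpt (o : Option (ConvSet X)) (ψ : X →₀ ℝ) : Prop := ∃ T, o = some T ∧ ψ ∈ T.carrier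

theorem memOpt_some {T : ConvSet X} {ψ : X →₀ ℝ} : MemOpt (some T) ψ ↔ ψ ∈ T.carrier := by
  simp [MemOpt]

theorem not_memOpt_none {ψ : X →₀ ℝ} : ¬ MemOpt none ψ := by
  simp [MemOpt]

theorem memOpt_ext {o p : Option (ConvSet X)} (h : ∀ ψ, MemOpt o ψ ↔ MemOpt p ψ) : o = p := by
  cases o with
  | none =>
    cases p with
    | none => rfl
    | some T =>
      exact absurd ((h _).2 (memOpt_some.2 T.nonempty.some_mem)) not_memOpt_none
  | some S =>
    cases p with
    | none => exact absurd ((h _).1 (memOpt_some.2 S.nonempty.some_mem)) not_memOpt_none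
    | some T =>
      congr 1
      ext ψ
      rw [← memOpt_some, h, memOpt_some]

theorem memOpt_gamma {S : ConvSet (Option X)} {ψ : X →₀ ℝ} :
    MemOpt (gammaFun S) ψ ↔ Finsupp.mapDomain some ψ ∈ S.carrier := by
  unfold gammaFun
  split_ifs with h
  · rw [memOpt_some]
    constructor
    · rintro ⟨φ, ⟨hφ, h0⟩, rfl⟩
      rwa [eq_mapDomain_some h0]
    · intro hψ
      exact ⟨_, ⟨hψ, mapDomain_some_none ψ⟩, some_mapDomain_some ψ⟩
  · refine iff_of_false not_memOpt_none fun hψ => h ⟨_, hψ, mapDomain_some_none ψ⟩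

theorem memOpt_map {f : X → Y} {o : Option (ConvSet X)} {ψ : Y →₀ ℝ} :
    MemOpt (Option.map (ConvSet.map f) o) ψ ↔ ∃ χ, MemOpt o χ ∧ Finsupp.mapDomain f χ = ψ := by
  cases o with
  | none => simp [MemOpt]
  | some T => simp [memOpt_some, ConvSet.mem_map]

theorem memOpt_mult {o : Option (ConvSet (ConvSet X))} {ψ : X →₀ ℝ} :
    MemOpt (Option.map ConvSet.mult o) ψ ↔ ∃ χ, MemOpt o χ ∧
      ∃ f : ConvSet X → (X →₀ ℝ), (∀ A, f A ∈ A.carrier) ∧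
        ψ = Finsupp.linearCombination ℝ f χ := by
  cases o with
  | none => simp [MemOpt]
  | some T => simp [memOpt_some, ConvSet.mem_mult]

/-- A nonnegative weight is not cancelled by a pushforward. -/
theorem mapDomain_ne_zero {I J : Type*} (k : I → J) {φ : I →₀ ℝ} (h : ∀ i, 0 ≤ φ i) {i : I}
    (hi : φ i ≠ 0) : Finsupp.mapDomain k φ (k i) ≠ 0 := by
  classical
  rw [Finsupp.mapDomain, Finsupp.sum_apply, Finsupp.sum]
  refine ne_of_gt (Finset.sum_pos' (fun j _ => ?_) ⟨i, by simpa using hi, ?_⟩)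
  · simp only [Finsupp.single_apply]
    split_ifs
    · exact h j
    · exact le_rfl
  · simpa using lt_of_le_of_ne (h i) (Ne.symm hi)

theorem gamma_map (f : X → Y) (S : ConvSet (Option X)) :
    gammaFun (S.map (Option.map f)) = Option.map (ConvSet.map f) (gammaFun S) := by
  refine memOpt_ext fun ψ => ?_
  rw [memOpt_gamma, memOpt_map, ConvSet.mem_map]
  constructor
  · rintro ⟨φ, hφ, e⟩
    have h0 : φ none = 0 := by
      by_contra h
      refine mapDomain_ne_zero (Option.map f) (S.nonneg hφ) h ?_
      rw [e]
      exact mapDomain_some_none ψ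
    refine ⟨φ.some, by rwa [memOpt_gamma, eq_mapDomain_some h0], ?_⟩
    apply Finsupp.mapDomain_injective (Option.some_injective Y)
    rw [← e, ← Finsupp.mapDomain_comp]
    conv_rhs => rw [← eq_mapDomain_some h0, ← Finsupp.mapDomain_comp]
    rfl
  · rintro ⟨χ, hχ, rfl⟩
    refine ⟨_, memOpt_gamma.1 hχ, ?_⟩
    rw [← Finsupp.mapDomain_comp, ← Finsupp.mapDomain_comp]
    rfl

theorem gamma_map_some (S : ConvSet X) : gammaFun (S.map some) = some S := by
  refine memOpt_ext fun ψ => ?_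
  rw [memOpt_gamma, memOpt_some, ConvSet.mem_map]
  constructor
  · rintro ⟨φ, hφ, e⟩
    rwa [← Finsupp.mapDomain_injective (Option.some_injective X) e]
  · exact fun h => ⟨ψ, h, rfl⟩

theorem gamma_unit (o : Option X) :
    gammaFun (ConvSet.unit o) = Option.map ConvSet.unit o := by
  refine memOpt_ext fun ψ => ?_
  rw [memOpt_gamma]
  cases o with
  | none =>
    refine iff_of_false (fun h => ?_) (by simp [MemOpt])
    have h' : Finsupp.mapDomain some ψ = Finsupp.single (none : Option X) (1 : ℝ) := h
    have := mapDomain_some_none ψ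
    rw [h'] at this
    simp at this
  | some x =>
    rw [Option.map_some, memOpt_some]
    constructor
    · intro h
      have h' : Finsupp.mapDomain some ψ = Finsupp.single (some x) (1 : ℝ) := h
      rw [← Finsupp.mapDomain_single] at h'
      exact Finsupp.mapDomain_injective (Option.some_injective X) h'
    · intro h
      have h' : ψ = Finsupp.single x 1 := h
      rw [h', Finsupp.mapDomain_single]
      rfl

theorem gamma_mult (S : ConvSet (ConvSet (Option X))) :
    gammaFun S.mult = Option.map ConvSet.mult (gammaFun (S.map gammaFun)) := by
  classical
  refine memOpt_ext fun ψ => ?_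
  rw [memOpt_gamma, memOpt_mult, ConvSet.mem_mult]
  constructor
  · rintro ⟨φ, hφ, f, hf, e⟩
    have hsum : ∑ A ∈ φ.support, φ A * f A none = 0 := by
      have := mapDomain_some_none ψ
      rw [e, Finsupp.linearCombination_apply, Finsupp.sum, Finsupp.finsetSum_apply] at this
      simpa using this
    have h0 : ∀ A, φ A ≠ 0 → f A none = 0 := by
      intro A hA
      have := (Finset.sum_eq_zero_iff_of_nonneg fun A _ =>
        mul_nonneg (S.nonneg hφ A) (A.nonneg (hf A) none)).1 hsum A (by simpa using hA)
      exact (mul_eq_zero.1 this).resolve_left hA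
    have hm : ∀ A, φ A ≠ 0 → MemOpt (gammaFun A) (f A).some := by
      intro A hA
      rw [memOpt_gamma, eq_mapDomain_some (h0 A hA)]
      exact hf A
    have hnone : Finsupp.mapDomain gammaFun φ none = 0 := by
      rw [Finsupp.mapDomain, Finsupp.sum_apply, Finsupp.sum]
      refine Finset.sum_eq_zero fun A hA => ?_
      obtain ⟨T, hT, -⟩ := hm A (by simpa using hA)
      rw [Finsupp.single_apply, if_neg (by simp [hT])]
    let B : Option (ConvSet X) → Set (X →₀ ℝ) := fun o => {z | ∀ T, o = some T → z ∈ T.carrier}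
    obtain ⟨g, hg, eg⟩ := merge_fiber B
      (by
        intro o z₁ h₁ z₂ h₂ a b ha hb hab T hT
        exact T.convex (h₁ T hT) (h₂ T hT) ha hb hab)
      (by
        intro o
        cases o with
        | none => exact ⟨0, fun T hT => by simp at hT⟩
        | some T =>
          refine ⟨T.nonempty.some, fun T' hT' => ?_⟩
          rw [← Option.some.inj hT']
          exact T.nonempty.some_mem)
      gammaFun φ (S.nonneg hφ) (fun A => (f A).some)
      (by
        intro A hA T hT
        obtain ⟨T', hT', hz⟩ := hm A hA
        rw [hT] at hT'
        rwa [Option.some.inj hT'])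
    refine ⟨(Finsupp.mapDomain gammaFun φ).some, ?_, fun T => g (some T),
      fun T => hg (some T) T rfl, ?_⟩
    · rw [memOpt_gamma, eq_mapDomain_some hnone]
      exact ⟨φ, hφ, rfl⟩
    · have h1 : Finsupp.linearCombination ℝ (fun T => g (some T))
          (Finsupp.mapDomain gammaFun φ).some =
          Finsupp.linearCombination ℝ g
            (Finsupp.mapDomain some (Finsupp.mapDomain gammaFun φ).some) := by
        rw [Finsupp.linearCombination_mapDomain]
        rfl
      rw [h1, eq_mapDomain_some hnone, eg]
      have h2 := Finsupp.apply_linearCombination ℝ (restrict X) f φ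
      rw [← e] at h2
      exact (some_mapDomain_some ψ).symm.trans h2
  · rintro ⟨χ, hχ, g, hg, rfl⟩
    obtain ⟨φ, hφ, e⟩ := memOpt_gamma.1 hχ
    have hsome : ∀ A, φ A ≠ 0 → ∃ T, gammaFun A = some T := by
      intro A hA
      have := mapDomain_ne_zero gammaFun (S.nonneg hφ) hA
      rw [e] at this
      cases hT : gammaFun A with
      | none =>
        rw [hT] at this
        exact absurd (mapDomain_some_none χ) this
      | some T => exact ⟨T, rfl⟩
    let G : Option (ConvSet X) → (X →₀ ℝ) := fun o => o.elim 0 g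
    let f : ConvSet (Option X) → (Option X →₀ ℝ) := fun A =>
      if φ A ≠ 0 then Finsupp.mapDomain some (G (gammaFun A)) else A.nonempty.some
    refine ⟨φ, hφ, f, fun A => ?_, ?_⟩
    · by_cases hA : φ A ≠ 0
      · obtain ⟨T, hT⟩ := hsome A hA
        simp only [f, if_pos hA]
        rw [← memOpt_gamma, hT, memOpt_some]
        exact hg T
      · simp only [f, if_neg hA]
        exact A.nonempty.some_mem
    · have h1 : Finsupp.linearCombination ℝ g χ =
          Finsupp.linearCombination ℝ G (Finsupp.mapDomain some χ) := by
        rw [Finsupp.linearCombination_mapDomain]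
        rfl
      rw [h1, ← e, Finsupp.linearCombination_mapDomain]
      have h2 := Finsupp.apply_linearCombination ℝ
        (Finsupp.lmapDomain ℝ ℝ (some : X → Option X)) (G ∘ gammaFun) φ
      rw [Finsupp.lmapDomain_apply] at h2
      rw [h2, Finsupp.linearCombination_apply, Finsupp.linearCombination_apply]
      refine Finset.sum_congr rfl fun A hA => ?_
      simp only [f, if_pos (Finsupp.mem_support_iff.1 hA)]
      rfl

theorem gamma_map_join (S : ConvSet (Option (Option X))) :
    gammaFun (S.map Option.join) = (Option.map gammaFun (gammaFun S)).join := by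
  refine memOpt_ext fun ψ => ?_
  have hr : MemOpt (Option.map gammaFun (gammaFun S)).join ψ ↔
      Finsupp.mapDomain some (Finsupp.mapDomain some ψ) ∈ S.carrier := by
    rw [← memOpt_gamma]
    cases gammaFun S with
    | none => simp [MemOpt]
    | some T => rw [Option.map_some, Option.join_some, memOpt_gamma, memOpt_some]
  rw [hr, memOpt_gamma, ConvSet.mem_map]
  constructor
  · rintro ⟨φ, hφ, e⟩
    have h0 : ∀ o : Option (Option X), o.join = none → φ o = 0 := by
      intro o ho
      by_contra h
      refine mapDomain_ne_zero Option.join (S.nonneg hφ) h ?_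
      rw [e, ho]
      exact mapDomain_some_none ψ
    have e1 := eq_mapDomain_some (h0 none rfl)
    have e2 : Finsupp.mapDomain some φ.some.some = φ.some :=
      eq_mapDomain_some (h0 (some none) rfl)
    have e3 : ψ = φ.some.some := by
      apply Finsupp.mapDomain_injective (Option.some_injective X)
      rw [← e, e2]
      conv_lhs => rw [← e1, ← Finsupp.mapDomain_comp]
      exact Finsupp.mapDomain_id
    rwa [e3, e2, e1]
  · intro h
    refine ⟨_, h, ?_⟩
    rw [← Finsupp.mapDomain_comp]
    exact Finsupp.mapDomain_id

/-- The monad `+ 1` on the category of sets, with `X + 1` given by `Option X` and `⋆` by `none`. -/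
abbrev maybeMonad : CategoryTheory.Monad (Type u) := ofTypeMonad Option

/-- `γ` is a distributive law of the monad `𝒞` over the monad `+ 1`. -/
noncomputable def gamma : DistributiveLaw convMonad.{u} maybeMonad.{u} where
  lam :=
    { app := fun _ => ↾gammaFun
      naturality := by
        intro X Y f
        refine ConcreteCategory.hom_ext _ _ fun S => ?_
        exact gamma_map f S }
  unit_right X := by
    refine ConcreteCategory.hom_ext _ _ fun S => ?_
    exact gamma_map_some S
  unit_left X := by
    refine ConcreteCategory.hom_ext _ _ fun o => ?_
    exact gamma_unit o
  mul_left X := by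
    refine ConcreteCategory.hom_ext _ _ fun S => ?_
    exact gamma_mult S
  mul_right X := by
    refine ConcreteCategory.hom_ext _ _ fun S => ?_
    have h : ∀ (Z : Type u) (o : Option (Option Z)), joinM o = o.join := by
      intro Z o
      cases o <;> rfl
    have h' : ∀ Z : Type u, (joinM : Option (Option Z) → Option Z) = Option.join :=
      fun Z => funext (h Z)
    change gammaFun (S.map joinM) = joinM (Option.map gammaFun (gammaFun S))
    rw [h', h']
    exact gamma_map_join S

/-- The monad `𝒞 + 1`, obtained by composing `𝒞` and `+ 1` along the distributive law `γ`. -/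
noncomputable def convPlusOne : CategoryTheory.Monad (Type u) := gamma.composite

end Gamma

section EquationalTheories

open FirstOrder

/-- An equation between terms in countably many variables. -/
abbrev Equation (L : Language) := L.Term ℕ × L.Term ℕ

/-- An algebra for the set of equations `E`: a set with an interpretation of the operations
satisfying every equation of `E` under every assignment of the variables.  (The algebras of the
theory generated by `E` are the algebras satisfying `E`.) -/
structure Alg {L : Language} (E : Set (Equation L)) where
  carrier : Type u
  [str : L.Structure carrier]
  sat : ∀ e ∈ E, ∀ v : ℕ → carrier, e.1.realize v = e.2.realize v

attribute [instance] Alg.str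

/-- The category `𝐀(E)` of `E`-algebras and homomorphisms. -/
instance Alg.category {L : Language} (E : Set (Equation L)) : Category (Alg.{u} E) where
  Hom A B := L.Hom A.carrier B.carrier
  id A := Language.Hom.id L A.carrier
  comp f g := Language.Hom.comp g f

/-- The underlying set functor. -/
def Alg.forget {L : Language} (E : Set (Equation L)) : Alg.{u} E ⥤ Type u where
  obj A := A.carrier
  map f := ↾(Language.Hom.toFun f)

/-- The operation symbols `⊕`, `+_p` for `p ∈ (0,1)`, and `⋆`, indexed by their arities. -/
inductive Op : ℕ → Type
  | oplus : Op 2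
  | pplus (p : Set.Ioo (0 : ℝ) 1) : Op 2
  | star : Op 0

/-- The signature of pointed convex semilattices (there are no relation symbols). -/
def sigma : Language := ⟨Op, fun _ => Empty⟩

/-- `s ⊕ t`. -/
def plus (s t : sigma.Term ℕ) : sigma.Term ℕ := Language.Term.func (L := sigma) Op.oplus ![s, t]

/-- `s +_p t`. -/
def pplus (p : Set.Ioo (0 : ℝ) 1) (s t : sigma.Term ℕ) : sigma.Term ℕ :=
  Language.Term.func (L := sigma) (Op.pplus p) ![s, t]

/-- The constant `⋆`. -/
def starTerm : sigma.Term ℕ := Language.Term.func (L := sigma) Op.star ![]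

/-- The variable `x`. -/
def varX : sigma.Term ℕ := Language.Term.var 0

/-- The variable `y`. -/
def varY : sigma.Term ℕ := Language.Term.var 1

/-- The variable `z`. -/
def varZ : sigma.Term ℕ := Language.Term.var 2

/-- `1 - p`. -/
def oneSub (p : Set.Ioo (0 : ℝ) 1) : Set.Ioo (0 : ℝ) 1 :=
  ⟨1 - p.1, by have := p.2.2; linarith, by have := p.2.1; linarith⟩

/-- `p q`. -/
def mulWeight (p q : Set.Ioo (0 : ℝ) 1) : Set.Ioo (0 : ℝ) 1 :=
  ⟨p.1 * q.1, mul_pos p.2.1 q.2.1, by nlinarith [p.2.1, p.2.2, q.2.1, q.2.2]⟩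

/-- `p (1 - q) / (1 - p q)`. -/
noncomputable def assocWeight (p q : Set.Ioo (0 : ℝ) 1) : Set.Ioo (0 : ℝ) 1 :=
  ⟨p.1 * (1 - q.1) / (1 - p.1 * q.1),
    div_pos (mul_pos p.2.1 (by linarith [q.2.2])) (by linarith [(mulWeight p q).2.2, show
      (mulWeight p q).1 = p.1 * q.1 from rfl]),
    (div_lt_one (by linarith [(mulWeight p q).2.2, show (mulWeight p q).1 = p.1 * q.1 from rfl])).2
      (by nlinarith [p.2.2])⟩

/-- The axioms of (pointed) convex semilattices; no axiom mentions `⋆`. -/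
inductive PointedConvexSemilattice : Equation sigma → Prop
  | A : PointedConvexSemilattice (plus varX (plus varY varZ), plus (plus varX varY) varZ)
  | C : PointedConvexSemilattice (plus varX varY, plus varY varX)
  | I : PointedConvexSemilattice (plus varX varX, varX)
  | Ap (p q : Set.Ioo (0 : ℝ) 1) : PointedConvexSemilattice
      (pplus p (pplus q varX varY) varZ, pplus (mulWeight p q) varX (pplus (assocWeight p q) varY varZ))
  | Cp (p : Set.Ioo (0 : ℝ) 1) : PointedConvexSemilattice (pplus p varX varY, pplus (oneSub p) varY varX)
  | Ip (p : Set.Ioo (0 : ℝ) 1) : PointedConvexSemilattice (pplus p varX varX, varX)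
  | D (p : Set.Ioo (0 : ℝ) 1) : PointedConvexSemilattice
      (pplus p varX (plus varY varZ), plus (pplus p varX varY) (pplus p varX varZ))

/-- The bottom axiom `x ⊕ ⋆ = x`. -/
def bottomAxiom : Set (Equation sigma) := {(plus varX starTerm, varX)}

/-- The black-hole axioms `x +_p ⋆ = ⋆`. -/
def blackHoleAxioms : Set (Equation sigma) := {e | ∃ p, e = (pplus p varX starTerm, starTerm)}

/-- The axioms of convex semilattices with bottom and black-hole. -/
def bottomBlackHole : Set (Equation sigma) :=
  {e | PointedConvexSemilattice e} ∪ bottomAxiom ∪ blackHoleAxioms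

end EquationalTheories

end ConvexMonad

/-!
The isomorphism rests on the fact that `𝒞 X + 1` is the free model on `X`. Reading `⋆` as the empty
set, an element of `𝒞 X + 1` is a possibly empty finitely generated convex set of distributions. On
such sets `⊕` is the convex hull of the union and `+_p` is the weighted Minkowski sum; the empty set
is a unit for the former (bottom) and absorbs the latter (black hole).

In an arbitrary model `A`, the operation `⊕` is a binary join with least element `⋆`, and the
operations `+_p` are monotone, idempotent and distribute over all finite joins, the empty one
included. The laws of the operations `+_p` say that points of `A` with nonnegative weights form a
commutative monoid (`Cone`), and summing in it gives an affine map `barycentre` from distributions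
on `A` to `A`. The evaluation `eval : 𝒞 A + 1 → A` sends a convex set to the join of the barycentres
of finitely many generators. Since the elements below a given one are closed under mixtures, this is
the join of the barycentres of all members (`isLUB_eval`), so the generators do not matter.

Evaluation is a homomorphism of models (`isBotConvexHom_eval`), homomorphisms commute with
evaluation (`IsBotConvexHom.map_eval`), and the multiplication of `𝒞 + 1` is the evaluation of the
free model (`freeMult_eq_eval`). Hence evaluation is an Eilenberg–Moore structure. Conversely, a
structure map `a : 𝒞 A + 1 → A` is surjective and transports the operations of the free model to
`A`; then `a` is a homomorphism and equals evaluation (`IsMonadAlgebra.eq_eval`). Both constructions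
keep underlying sets and maps, and they are mutually inverse.
-/

namespace ConvexMonad

/-! ### Convex semilattices with bottom and black hole -/

/-- A convex semilattice with bottom and black hole, that is, a model of the equations
`bottomBlackHole`, given by its operations `⊕`, `+_p` (here `mix p`) and `⋆` on the type `A`. -/
class BotConvexSemilattice (A : Type u) where
  oplus : A → A → A
  mix : Set.Ioo (0 : ℝ) 1 → A → A → A
  star : A
  oplus_assoc : ∀ x y z, oplus x (oplus y z) = oplus (oplus x y) z
  oplus_comm : ∀ x y, oplus x y = oplus y x
  oplus_self : ∀ x, oplus x x = x
  mix_assoc : ∀ p q x y z,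
    mix p (mix q x y) z = mix (mulWeight p q) x (mix (assocWeight p q) y z)
  mix_comm : ∀ p x y, mix p x y = mix (oneSub p) y x
  mix_self : ∀ p x, mix p x x = x
  mix_oplus : ∀ p x y z, mix p x (oplus y z) = oplus (mix p x y) (mix p x z)
  oplus_star : ∀ x, oplus x star = x
  mix_star : ∀ p x, mix p x star = star

namespace BotConvexSemilattice

variable {A : Type u} [BotConvexSemilattice A]

/-- The order `x ≤ y ↔ x ⊕ y = y`, for which `⊕` is the join. -/
instance : SemilatticeSup A :=
  letI : Max A := ⟨oplus⟩
  SemilatticeSup.mk' oplus_comm (fun x y z => (oplus_assoc x y z).symm) oplus_self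

/-- The constant `⋆` is the least element, by the bottom axiom. -/
instance : OrderBot A where
  bot := star
  bot_le x := by
    rw [← sup_eq_right, sup_comm]
    exact oplus_star x

theorem mix_sup_right (p : Set.Ioo (0 : ℝ) 1) (x y z : A) :
    mix p x (y ⊔ z) = mix p x y ⊔ mix p x z := mix_oplus p x y z

theorem mix_sup_left (p : Set.Ioo (0 : ℝ) 1) (x y z : A) :
    mix p (x ⊔ y) z = mix p x z ⊔ mix p y z := by
  rw [mix_comm, mix_sup_right, ← mix_comm, ← mix_comm]

theorem mix_bot_right (p : Set.Ioo (0 : ℝ) 1) (x : A) : mix p x ⊥ = ⊥ := mix_star p x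

theorem mix_bot_left (p : Set.Ioo (0 : ℝ) 1) (x : A) : mix p ⊥ x = ⊥ := by
  rw [mix_comm, mix_bot_right]

theorem mix_mono (p : Set.Ioo (0 : ℝ) 1) {x x' y y' : A} (hx : x ≤ x') (hy : y ≤ y') :
    mix p x y ≤ mix p x' y' := by
  have h1 := mix_sup_left p x x' y
  have h2 := mix_sup_right p x' y y'
  rw [sup_eq_right.2 hx] at h1
  rw [sup_eq_right.2 hy] at h2
  exact (sup_eq_right.1 h1.symm).trans (sup_eq_right.1 h2.symm)

/-- The elements below `u` are closed under mixtures; this is why a join of elements is not changed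
by adding mixtures of them. -/
theorem mix_le (p : Set.Ioo (0 : ℝ) 1) {x y u : A} (hx : x ≤ u) (hy : y ≤ u) :
    mix p x y ≤ u := (mix_mono p hx hy).trans_eq (mix_self p u)

/-- `+_p` preserves finite joins in both arguments.  The empty join is covered by the black-hole
axiom. -/
theorem mix_finsetSup {I J : Type*} (p : Set.Ioo (0 : ℝ) 1) (s : Finset I) (t : Finset J)
    (f : I → A) (g : J → A) :
    mix p (s.sup f) (t.sup g) = s.sup fun i => t.sup fun j => mix p (f i) (g j) := by
  rw [Finset.apply_sup_eq_sup_comp (fun x => mix p x (t.sup g)) (fun x y => mix_sup_left p x y _)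
    (mix_bot_left p _)]
  refine Finset.sup_congr rfl fun i _ => ?_
  exact Finset.apply_sup_eq_sup_comp (mix p (f i)) (mix_sup_right p _) (mix_bot_right p _)

end BotConvexSemilattice

/-! ### Barycentres -/

/-- A point of `A` together with a positive weight. -/
@[ext]
structure WeightedPoint (A : Type u) where
  weight : {r : ℝ // 0 < r}
  point : A

namespace WeightedPoint

variable {A : Type u}

/-- Rescaling of the weight. -/
def scale (c : {r : ℝ // 0 < r}) (a : WeightedPoint A) : WeightedPoint A :=
  ⟨⟨c.1 * a.weight.1, mul_pos c.2 a.weight.2⟩, a.point⟩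

/-- The fraction `r / (r + s)` as an element of the open unit interval. -/
noncomputable def fraction (r s : {r : ℝ // 0 < r}) : Set.Ioo (0 : ℝ) 1 :=
  ⟨r.1 / (r.1 + s.1), div_pos r.2 (add_pos r.2 s.2),
    (div_lt_one (add_pos r.2 s.2)).2 (lt_add_of_pos_right _ s.2)⟩

variable [BotConvexSemilattice A]

open BotConvexSemilattice

/-- Weights are added, and points are mixed in proportion to their weights. -/
noncomputable instance : Add (WeightedPoint A) :=
  ⟨fun a b => ⟨⟨a.weight.1 + b.weight.1, add_pos a.weight.2 b.weight.2⟩,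
    mix (fraction a.weight b.weight) a.point b.point⟩⟩

theorem add_def (a b : WeightedPoint A) : a + b =
    ⟨⟨a.weight.1 + b.weight.1, add_pos a.weight.2 b.weight.2⟩,
      mix (fraction a.weight b.weight) a.point b.point⟩ := rfl

noncomputable instance : AddCommSemigroup (WeightedPoint A) where
  add_assoc := by
    rintro ⟨⟨r, hr⟩, x⟩ ⟨⟨s, hs⟩, y⟩ ⟨⟨t, ht⟩, z⟩
    simp only [add_def]
    ext
    · exact add_assoc r s t
    · rw [mix_assoc]
      have e1 : mulWeight (fraction ⟨r + s, add_pos hr hs⟩ ⟨t, ht⟩) (fraction ⟨r, hr⟩ ⟨s, hs⟩) =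
          fraction ⟨r, hr⟩ ⟨s + t, add_pos hs ht⟩ := by
        ext
        simp only [mulWeight, fraction]
        field_simp
        ring
      have e2 : assocWeight (fraction ⟨r + s, add_pos hr hs⟩ ⟨t, ht⟩)
          (fraction ⟨r, hr⟩ ⟨s, hs⟩) = fraction ⟨s, hs⟩ ⟨t, ht⟩ := by
        ext
        have h : (r + s) / (r + s + t) * (r / (r + s)) = r / (r + s + t) := by field_simp
        have h' : 1 - r / (r + s + t) = (s + t) / (r + s + t) := by
          field_simp
          ring
        have h'' : 1 - r / (r + s) = s / (r + s) := by
          field_simp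
          ring
        simp only [assocWeight, fraction]
        rw [h, h', h'']
        field_simp
      rw [e1, e2]
  add_comm := by
    rintro ⟨⟨r, hr⟩, x⟩ ⟨⟨s, hs⟩, y⟩
    simp only [add_def]
    ext
    · exact add_comm r s
    · change mix _ x y = mix _ y x
      rw [mix_comm]
      congr 1
      ext
      change 1 - r / (r + s) = s / (s + r)
      field_simp
      ring

theorem scale_add (c : {r : ℝ // 0 < r}) (a b : WeightedPoint A) :
    scale c (a + b) = scale c a + scale c b := by
  simp only [add_def, scale]
  ext
  · exact mul_add _ _ _
  · simp only
    congr 1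
    ext
    have := c.2
    have := a.weight.2
    have := b.weight.2
    simp only [fraction]
    rw [← mul_add, mul_div_mul_left _ _ c.2.ne']

end WeightedPoint

/-- The commutative monoid of points of `A` with nonnegative weights, where all points of weight
`0` are identified.  In it, the mixing operations become a single addition. -/
abbrev Cone (A : Type u) := WithZero (WeightedPoint A)

namespace Cone

variable {A : Type u}

open Classical in
/-- The point `x` with weight `r`; a negative weight counts as `0`. -/
noncomputable def of (r : ℝ) (x : A) : Cone A :=
  if h : 0 < r then ((⟨⟨r, h⟩, x⟩ : WeightedPoint A) : Cone A) else 0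

theorem of_pos {r : ℝ} (h : 0 < r) (x : A) :
    of r x = ((⟨⟨r, h⟩, x⟩ : WeightedPoint A) : Cone A) := dif_pos h

theorem of_zero (x : A) : of 0 x = 0 := dif_neg (lt_irrefl 0)

variable [BotConvexSemilattice A]

open BotConvexSemilattice

/-- The point underlying an element of the cone, with value `⊥` at the apex. -/
def point (a : Cone A) : A := WithZero.recZeroCoe ⊥ WeightedPoint.point a

theorem point_of {r : ℝ} (h : 0 < r) (x : A) : point (of r x) = x := by
  rw [of_pos h]
  rfl

theorem of_add_of_pos {r s : ℝ} (hr : 0 < r) (hs : 0 < s) (x y : A) :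
    of r x + of s y = of (r + s) (mix (WeightedPoint.fraction ⟨r, hr⟩ ⟨s, hs⟩) x y) := by
  rw [of_pos hr, of_pos hs, of_pos (add_pos hr hs), ← WithZero.coe_add]
  rfl

theorem of_add {r s : ℝ} (hr : 0 ≤ r) (hs : 0 ≤ s) (x : A) :
    of (r + s) x = of r x + of s x := by
  rcases hr.eq_or_lt with rfl | hr
  · rw [zero_add, of_zero, zero_add]
  rcases hs.eq_or_lt with rfl | hs
  · rw [add_zero, of_zero, add_zero]
  rw [of_add_of_pos hr hs, mix_self]

theorem exists_of_add_of {r s : ℝ} (hr : 0 ≤ r) (hs : 0 ≤ s) (x y : A) :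
    ∃ z, of r x + of s y = of (r + s) z := by
  rcases hr.eq_or_lt with rfl | hr
  · exact ⟨y, by rw [zero_add, of_zero, zero_add]⟩
  rcases hs.eq_or_lt with rfl | hs
  · exact ⟨x, by rw [add_zero, of_zero, add_zero]⟩
  exact ⟨_, of_add_of_pos hr hs x y⟩

/-- Multiplication by a positive real number. -/
noncomputable def scale (c : {r : ℝ // 0 < r}) : Cone A →+ Cone A :=
  WithZero.mapAddHom ⟨WeightedPoint.scale c, WeightedPoint.scale_add c⟩

theorem scale_of (c : {r : ℝ // 0 < r}) (r : ℝ) (x : A) : scale c (of r x) = of (c.1 * r) x := by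
  by_cases h : 0 < r
  · rw [of_pos h, of_pos (mul_pos c.2 h)]
    rfl
  · have h' : ¬ 0 < c.1 * r := fun h' => h (pos_of_mul_pos_right h' c.2.le)
    simp only [of, dif_neg h, dif_neg h']
    rfl

/-- The sum in the cone of the points of `A`, weighted by `φ`. -/
noncomputable def total (φ : A →₀ ℝ) : Cone A := φ.sum fun x r => of r x

theorem total_add {φ ψ : A →₀ ℝ} (hφ : ∀ x, 0 ≤ φ x) (hψ : ∀ x, 0 ≤ ψ x) :
    total (φ + ψ) = total φ + total ψ := by
  classical
  have h0 : ∀ x ∈ φ.support ∪ ψ.support, of 0 x = (0 : Cone A) := fun x _ => of_zero x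
  rw [total, total, total, Finsupp.sum_of_support_subset _ Finsupp.support_add _ h0,
    Finsupp.sum_of_support_subset _ Finset.subset_union_left _ h0,
    Finsupp.sum_of_support_subset _ Finset.subset_union_right _ h0, ← Finset.sum_add_distrib]
  exact Finset.sum_congr rfl fun x _ => of_add (hφ x) (hψ x) x

theorem total_smul (c : {r : ℝ // 0 < r}) (φ : A →₀ ℝ) :
    total (c.1 • φ) = scale c (total φ) := by
  rw [total, Finsupp.sum_smul_index (fun x => of_zero x), total, Finsupp.sum, Finsupp.sum, map_sum]
  exact Finset.sum_congr rfl fun x _ => (scale_of c _ x).symm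

/-- The weight of a sum in the cone is the sum of the weights.  The point `x₀` is needed only for
the empty sum. -/
theorem exists_sum_eq_of {I : Type*} (x₀ : A) (s : Finset I) (w : I → ℝ) (hw : ∀ i, 0 ≤ w i)
    (f : I → A) : ∃ z, ∑ i ∈ s, of (w i) (f i) = of (∑ i ∈ s, w i) z := by
  classical
  induction s using Finset.induction_on with
  | empty => exact ⟨x₀, by simp [of_zero]⟩
  | insert i s hi ih =>
    obtain ⟨z, hz⟩ := ih
    rw [Finset.sum_insert hi, Finset.sum_insert hi, hz]
    exact exists_of_add_of (hw i) (Finset.sum_nonneg fun j _ => hw j) _ _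

end Cone

section Barycentre

variable {A : Type u} [BotConvexSemilattice A]

open BotConvexSemilattice

/-- The barycentre in `A` of a distribution on `A`. -/
noncomputable def barycentre (φ : A →₀ ℝ) : A := (Cone.total φ).point

theorem barycentre_single (x : A) : barycentre (Finsupp.single x 1) = x := by
  rw [barycentre, Cone.total, Finsupp.sum_single_index (Cone.of_zero x), Cone.point_of one_pos]

theorem total_eq_of_barycentre {φ : A →₀ ℝ} (h : φ ∈ probDist A) :
    Cone.total φ = Cone.of 1 (barycentre φ) := by
  obtain ⟨z, hz⟩ := Cone.exists_sum_eq_of (⊥ : A) φ.support φ h.1 id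
  have hz' : Cone.total φ = Cone.of 1 z := by
    rw [← h.2]
    exact hz
  rw [barycentre, hz', Cone.point_of one_pos]

/-- The barycentre map is affine. -/
theorem barycentre_mix (p : Set.Ioo (0 : ℝ) 1) {φ ψ : A →₀ ℝ} (hφ : φ ∈ probDist A)
    (hψ : ψ ∈ probDist A) :
    barycentre (p.1 • φ + (1 - p.1) • ψ) = mix p (barycentre φ) (barycentre ψ) := by
  have hp : 0 < 1 - p.1 := (oneSub p).2.1
  have h1 := Cone.total_smul ⟨p.1, p.2.1⟩ φ
  have h2 := Cone.total_smul ⟨1 - p.1, hp⟩ ψ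
  rw [total_eq_of_barycentre hφ, Cone.scale_of, mul_one] at h1
  rw [total_eq_of_barycentre hψ, Cone.scale_of, mul_one] at h2
  simp only at h1 h2
  rw [barycentre, Cone.total_add (fun x => mul_nonneg p.2.1.le (hφ.1 x))
    (fun x => mul_nonneg hp.le (hψ.1 x)), h1, h2, Cone.of_add_of_pos p.2.1 hp,
    Cone.point_of (by linarith)]
  congr 1
  ext
  simp [WeightedPoint.fraction]

end Barycentre

/-- A property of distributions that holds for the Dirac distributions and is preserved by binary
convex combinations holds for all distributions. -/
theorem probDist_induction {X : Type u} {P : (X →₀ ℝ) → Prop}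
    (single : ∀ x, P (Finsupp.single x 1))
    (mix : ∀ (p : Set.Ioo (0 : ℝ) 1) (φ ψ : X →₀ ℝ), φ ∈ probDist X → ψ ∈ probDist X → P φ → P ψ →
      P (p.1 • φ + (1 - p.1) • ψ))
    {φ : X →₀ ℝ} (hφ : φ ∈ probDist X) : P φ := by
  have hconv : Convex ℝ {φ | φ ∈ probDist X ∧ P φ} := by
    intro φ hφ ψ hψ a b ha hb hab
    refine ⟨convex_dist hφ.1 hψ.1 ha hb hab, ?_⟩
    obtain rfl : b = 1 - a := by linarith
    rcases ha.eq_or_lt with rfl | ha'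
    · simpa using hψ.2
    rcases hb.eq_or_lt with hb' | hb'
    · obtain rfl : a = 1 := by linarith
      simpa using hφ.2
    exact mix ⟨a, ha', by linarith⟩ φ ψ hφ.1 hψ.1 hφ.2 hψ.2
  rw [← linearCombination_single_one φ]
  exact (linearCombination_mem hconv hφ.1 hφ.2
    fun x => ⟨(ConvSet.unit x).subset_dist rfl, single x⟩).2

/-! ### The free convex semilattice with bottom and black hole -/

section Free

open scoped Pointwise
open BotConvexSemilattice

variable {X Y : Type u}

/-- The distributions in an element of `𝒞 X + 1`, where `⋆` is seen as the empty set. -/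
def members (o : Option (ConvSet X)) : Set (X →₀ ℝ) := {ψ | MemOpt o ψ}

theorem members_none : members (none : Option (ConvSet X)) = ∅ :=
  Set.eq_empty_of_forall_notMem fun _ => not_memOpt_none

theorem members_some (S : ConvSet X) : members (some S) = S.carrier :=
  Set.ext fun _ => memOpt_some

theorem members_injective : Function.Injective (members (X := X)) :=
  fun _ _ h => memOpt_ext fun ψ => Set.ext_iff.1 h ψ

theorem members_subset (o : Option (ConvSet X)) : members o ⊆ probDist X := by
  rintro ψ ⟨S, -, hψ⟩
  exact S.subset_dist hψ

theorem exists_members_eq_convexHull (o : Option (ConvSet X)) :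
    ∃ F : Finset (X →₀ ℝ), members o = convexHull ℝ F := by
  cases o with
  | none => exact ⟨∅, by simp [members_none]⟩
  | some S =>
    obtain ⟨F, hF, h⟩ := S.finitely_generated
    exact ⟨hF.toFinset, by rw [members_some, h, hF.coe_toFinset]⟩

theorem convex_members (o : Option (ConvSet X)) : Convex ℝ (members o) := by
  obtain ⟨F, h⟩ := exists_members_eq_convexHull o
  rw [h]
  exact convex_convexHull ℝ _

theorem convexHull_members (o : Option (ConvSet X)) : convexHull ℝ (members o) = members o :=
  (convex_members o).convexHull_eq

open Classical in
/-- The element of `𝒞 X + 1` with a given finitely generated set of distributions as its set of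
members.  If `K` is not of this kind, the value is `⋆`. -/
noncomputable def ofMembers (K : Set (X →₀ ℝ)) : Option (ConvSet X) :=
  if h : ∃ o, members o = K then h.choose else none

theorem members_ofMembers {K : Set (X →₀ ℝ)} (hK : K ⊆ probDist X)
    (hfg : ∃ F : Set (X →₀ ℝ), F.Finite ∧ K = convexHull ℝ F) : members (ofMembers K) = K := by
  have h : ∃ o, members o = K := by
    rcases K.eq_empty_or_nonempty with rfl | hne
    · exact ⟨none, members_none⟩
    · exact ⟨some ⟨K, hK, hne, hfg⟩, members_some _⟩
  rw [ofMembers, dif_pos h]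
  exact h.choose_spec

/-- The join of two elements of `𝒞 X + 1`: the convex hull of the union. -/
noncomputable def freeOplus (o o' : Option (ConvSet X)) : Option (ConvSet X) :=
  ofMembers (convexHull ℝ (members o ∪ members o'))

/-- The mixture of two elements of `𝒞 X + 1`: the weighted Minkowski sum, which is empty as soon
as one of the summands is. -/
noncomputable def freeMix (p : Set.Ioo (0 : ℝ) 1) (o o' : Option (ConvSet X)) :
    Option (ConvSet X) :=
  ofMembers (p.1 • members o + (1 - p.1) • members o')

theorem members_freeOplus (o o' : Option (ConvSet X)) :
    members (freeOplus o o') = convexHull ℝ (members o ∪ members o') := by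
  refine members_ofMembers
    (convexHull_min (Set.union_subset (members_subset o) (members_subset o')) convex_dist) ?_
  obtain ⟨F, hF⟩ := exists_members_eq_convexHull o
  obtain ⟨G, hG⟩ := exists_members_eq_convexHull o'
  refine ⟨F ∪ G, F.finite_toSet.union G.finite_toSet, ?_⟩
  rw [hF, hG, convexHull_convexHull_union_left, convexHull_convexHull_union_right]

theorem members_freeMix (p : Set.Ioo (0 : ℝ) 1) (o o' : Option (ConvSet X)) :
    members (freeMix p o o') = p.1 • members o + (1 - p.1) • members o' := by
  refine members_ofMembers ?_ ?_
  · rintro _ ⟨_, ⟨φ, hφ, rfl⟩, _, ⟨ψ, hψ, rfl⟩, rfl⟩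
    exact convex_dist (members_subset o hφ) (members_subset o' hψ) p.2.1.le (oneSub p).2.1.le
      (by ring)
  · obtain ⟨F, hF⟩ := exists_members_eq_convexHull o
    obtain ⟨G, hG⟩ := exists_members_eq_convexHull o'
    refine ⟨p.1 • (F : Set (X →₀ ℝ)) + (1 - p.1) • (G : Set (X →₀ ℝ)),
      (F.finite_toSet.image _).add (G.finite_toSet.image _), ?_⟩
    rw [hF, hG, convexHull_add, convexHull_smul, convexHull_smul]

/-- The free model on `X`.  The equations hold because, on sets of members, they are identities
between convex hulls and Minkowski sums. -/
noncomputable instance : BotConvexSemilattice (Option (ConvSet X)) where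
  oplus := freeOplus
  mix := freeMix
  star := none
  oplus_assoc x y z := members_injective <| by
    simp only [members_freeOplus]
    rw [convexHull_convexHull_union_left, convexHull_convexHull_union_right, Set.union_assoc]
  oplus_comm x y := members_injective <| by
    rw [members_freeOplus, members_freeOplus, Set.union_comm]
  oplus_self x := members_injective <| by
    rw [members_freeOplus, Set.union_self, convexHull_members]
  mix_assoc p q x y z := members_injective <| by
    have h1 : 0 < 1 - p.1 * q.1 := (oneSub (mulWeight p q)).2.1
    have e1 : (1 - p.1 * q.1) * (p.1 * (1 - q.1) / (1 - p.1 * q.1)) = p.1 * (1 - q.1) := by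
      field_simp
    have e2 : (1 - p.1 * q.1) * (1 - p.1 * (1 - q.1) / (1 - p.1 * q.1)) = 1 - p.1 := by
      field_simp
      ring
    simp only [members_freeMix, smul_add, smul_smul, mulWeight, assocWeight, e1, e2, add_assoc]
  mix_comm p x y := members_injective <| by
    simp only [members_freeMix, oneSub, sub_sub_cancel]
    exact add_comm _ _
  mix_self p x := members_injective <| by
    rw [members_freeMix, ← (convex_members x).add_smul p.2.1.le (sub_nonneg.2 p.2.2.le),
      add_sub_cancel, one_smul]
  mix_oplus p x y z := members_injective <| by
    simp only [members_freeMix, members_freeOplus]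
    rw [← Set.add_union, ← Set.smul_set_union, convexHull_add, convexHull_smul, convexHull_smul,
      convexHull_members]
  oplus_star x := members_injective <| by
    rw [members_freeOplus, members_none, Set.union_empty, convexHull_members]
  mix_star p x := members_injective <| by
    rw [members_freeMix, members_none, Set.smul_set_empty, Set.add_empty]

theorem members_sup (o o' : Option (ConvSet X)) :
    members (o ⊔ o') = convexHull ℝ (members o ∪ members o') := members_freeOplus o o'

theorem members_mix (p : Set.Ioo (0 : ℝ) 1) (o o' : Option (ConvSet X)) :
    members (mix p o o') = p.1 • members o + (1 - p.1) • members o' := members_freeMix p o o'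

/-- The order of the free model is inclusion. -/
theorem members_subset_members {o o' : Option (ConvSet X)} : members o ⊆ members o' ↔ o ≤ o' := by
  rw [← sup_eq_right (a := o)]
  constructor
  · intro h
    refine members_injective ?_
    rw [members_sup, Set.union_eq_right.2 h, convexHull_members]
  · intro h
    rw [← h, members_sup]
    exact Set.subset_union_left.trans (subset_convexHull ℝ _)

/-- Homomorphisms of convex semilattices with bottom and black hole. -/
structure IsBotConvexHom {A B : Type*} [BotConvexSemilattice A] [BotConvexSemilattice B]
    (f : A → B) : Prop where
  map_sup : ∀ x y, f (x ⊔ y) = f x ⊔ f y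
  map_mix : ∀ p x y, f (mix p x y) = mix p (f x) (f y)
  map_bot : f ⊥ = ⊥

/-- The action of the functor `𝒞 + 1` on a map. -/
noncomputable def freeMap (f : X → Y) : Option (ConvSet X) → Option (ConvSet Y) :=
  Option.map (ConvSet.map f)

/-- The unit of the monad `𝒞 + 1`. -/
noncomputable def freeUnit (x : X) : Option (ConvSet X) := some (ConvSet.unit x)

theorem members_freeUnit (x : X) : members (freeUnit x) = {Finsupp.single x 1} := members_some _

theorem members_freeMap (f : X → Y) (o : Option (ConvSet X)) :
    members (freeMap f o) = Finsupp.lmapDomain ℝ ℝ f '' members o :=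
  Set.ext fun _ => memOpt_map

theorem freeMap_freeUnit (f : X → Y) (x : X) : freeMap f (freeUnit x) = freeUnit (f x) :=
  congrArg some (ConvSet.map_unit f x)

theorem isBotConvexHom_freeMap (f : X → Y) : IsBotConvexHom (freeMap f) where
  map_sup o o' := members_injective <| by
    rw [members_freeMap, members_sup, members_sup, LinearMap.image_convexHull, Set.image_union,
      members_freeMap, members_freeMap]
  map_mix p o o' := members_injective <| by
    rw [members_freeMap, members_mix, members_mix, Set.image_add, image_smul_set,
      image_smul_set, members_freeMap, members_freeMap]
  map_bot := rfl

end Free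

/-! ### Evaluation of finitely generated convex sets -/

section Evaluation

open scoped Pointwise
open BotConvexSemilattice

variable {A B : Type u} [BotConvexSemilattice A] [BotConvexSemilattice B]

theorem convex_barycentre_le (u : A) : Convex ℝ {φ | φ ∈ probDist A ∧ barycentre φ ≤ u} := by
  intro φ hφ ψ hψ a b ha hb hab
  refine ⟨convex_dist hφ.1 hψ.1 ha hb hab, ?_⟩
  obtain rfl : b = 1 - a := by linarith
  rcases ha.eq_or_lt with rfl | ha'
  · simpa using hψ.2
  rcases hb.eq_or_lt with hb' | hb'
  · obtain rfl : a = 1 := by linarith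
    simpa using hφ.2
  rw [barycentre_mix ⟨a, ha', by linarith⟩ hφ.1 hψ.1]
  exact mix_le _ hφ.2 hψ.2

/-- The structure map `𝒞 A + 1 → A`: the join of the barycentres of a finite set of generators. -/
noncomputable def eval (o : Option (ConvSet A)) : A :=
  (exists_members_eq_convexHull o).choose.sup barycentre

theorem exists_eval_eq (o : Option (ConvSet A)) : ∃ F : Finset (A →₀ ℝ),
    (F : Set (A →₀ ℝ)) ⊆ members o ∧ eval o = F.sup barycentre := by
  refine ⟨_, ?_, rfl⟩
  have h := (exists_members_eq_convexHull o).choose_spec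
  exact (subset_convexHull ℝ _).trans h.superset

/-- Although `eval` is defined by means of generators, it is the join of the barycentres of all
members, because the elements below a given one are closed under mixtures.  In particular it does
not depend on the generators. -/
theorem isLUB_eval (o : Option (ConvSet A)) : IsLUB (barycentre '' members o) (eval o) := by
  constructor
  · rintro _ ⟨φ, hφ, rfl⟩
    have h := (exists_members_eq_convexHull o).choose_spec
    have hsub : members o ⊆ {φ | φ ∈ probDist A ∧ barycentre φ ≤ eval o} := by
      conv_lhs => rw [h]
      refine convexHull_min (fun ψ hψ => ⟨?_, Finset.le_sup (f := barycentre) hψ⟩)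
        (convex_barycentre_le _)
      exact members_subset o (h.superset (subset_convexHull ℝ _ hψ))
    exact (hsub hφ).2
  · intro u hu
    obtain ⟨F, hF, e⟩ := exists_eval_eq o
    rw [e]
    exact Finset.sup_le fun φ hφ => hu ⟨φ, hF hφ, rfl⟩

theorem eval_freeUnit (x : A) : eval (freeUnit x) = x := by
  have h := isLUB_eval (freeUnit x)
  rw [members_freeUnit, Set.image_singleton, barycentre_single] at h
  exact h.unique isLUB_singleton

/-- The evaluation map is a homomorphism on the free model on `A`.  For mixtures this is the
distributivity of `+_p` over finite joins. -/
theorem isBotConvexHom_eval : IsBotConvexHom (eval (A := A)) where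
  map_sup o o' := by
    refine (isLUB_eval _).unique ⟨?_, fun u hu => ?_⟩
    · rintro _ ⟨φ, hφ, rfl⟩
      rw [members_sup] at hφ
      refine (convexHull_min ?_ (convex_barycentre_le (eval o ⊔ eval o')) hφ).2
      rintro ψ (hψ | hψ)
      · exact ⟨members_subset _ hψ, ((isLUB_eval o).1 ⟨ψ, hψ, rfl⟩).trans le_sup_left⟩
      · exact ⟨members_subset _ hψ, ((isLUB_eval o').1 ⟨ψ, hψ, rfl⟩).trans le_sup_right⟩
    · rw [members_sup] at hu
      refine sup_le ((isLUB_eval o).2 ?_) ((isLUB_eval o').2 ?_)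
      · rintro _ ⟨ψ, hψ, rfl⟩
        exact hu ⟨ψ, subset_convexHull ℝ _ (Or.inl hψ), rfl⟩
      · rintro _ ⟨ψ, hψ, rfl⟩
        exact hu ⟨ψ, subset_convexHull ℝ _ (Or.inr hψ), rfl⟩
  map_mix p o o' := by
    refine (isLUB_eval _).unique ⟨?_, fun u hu => ?_⟩
    · rintro _ ⟨φ, hφ, rfl⟩
      rw [members_mix] at hφ
      obtain ⟨_, ⟨φ, hφ, rfl⟩, _, ⟨ψ, hψ, rfl⟩, rfl⟩ := hφ
      simp only
      rw [barycentre_mix p (members_subset _ hφ) (members_subset _ hψ)]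
      exact mix_mono p ((isLUB_eval o).1 ⟨φ, hφ, rfl⟩) ((isLUB_eval o').1 ⟨ψ, hψ, rfl⟩)
    · rw [members_mix] at hu
      obtain ⟨F, hF, e⟩ := exists_eval_eq o
      obtain ⟨G, hG, e'⟩ := exists_eval_eq o'
      rw [e, e', mix_finsetSup]
      refine Finset.sup_le fun φ hφ => Finset.sup_le fun ψ hψ => ?_
      rw [← barycentre_mix p (members_subset _ (hF hφ)) (members_subset _ (hG hψ))]
      exact hu ⟨_, Set.add_mem_add (Set.smul_mem_smul_set (hF hφ))
        (Set.smul_mem_smul_set (hG hψ)), rfl⟩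
  map_bot := by
    refine (isLUB_eval _).unique ?_
    change IsLUB (barycentre '' members none) ⊥
    rw [members_none, Set.image_empty]
    exact isLUB_empty

theorem IsBotConvexHom.map_barycentre {f : A → B} (hf : IsBotConvexHom f) {φ : A →₀ ℝ}
    (hφ : φ ∈ probDist A) : f (barycentre φ) = barycentre (Finsupp.lmapDomain ℝ ℝ f φ) := by
  refine probDist_induction (P := fun φ => f (barycentre φ) =
    barycentre (Finsupp.lmapDomain ℝ ℝ f φ)) ?_ ?_ hφ
  · intro x
    simp [barycentre_single]
  · intro p φ ψ hφ hψ h1 h2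
    rw [barycentre_mix p hφ hψ, hf.map_mix, h1, h2, map_add, map_smul, map_smul]
    exact (barycentre_mix p (mapDomain_mem_dist f hφ) (mapDomain_mem_dist f hψ)).symm

theorem IsBotConvexHom.mono {f : A → B} (hf : IsBotConvexHom f) : Monotone f := by
  intro x y h
  rw [← sup_eq_right, ← hf.map_sup, sup_eq_right.2 h]

/-- Homomorphisms commute with evaluation. -/
theorem IsBotConvexHom.map_eval {f : A → B} (hf : IsBotConvexHom f) (o : Option (ConvSet A)) :
    f (eval o) = eval (freeMap f o) := by
  refine IsLUB.unique ⟨?_, fun u hu => ?_⟩ (isLUB_eval (freeMap f o))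
  · rw [members_freeMap]
    rintro _ ⟨_, ⟨φ, hφ, rfl⟩, rfl⟩
    rw [← hf.map_barycentre (members_subset o hφ)]
    exact hf.mono ((isLUB_eval o).1 ⟨φ, hφ, rfl⟩)
  · rw [members_freeMap] at hu
    obtain ⟨F, hF, e⟩ := exists_eval_eq o
    rw [e, Finset.apply_sup_eq_sup_comp f hf.map_sup hf.map_bot]
    refine Finset.sup_le fun φ hφ => ?_
    rw [Function.comp_apply, hf.map_barycentre (members_subset o (hF hφ))]
    exact hu ⟨_, ⟨φ, hF hφ, rfl⟩, rfl⟩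

end Evaluation

/-! ### The multiplication of the composite monad -/

section Multiplication

open scoped Pointwise
open BotConvexSemilattice

variable {X : Type u}

/-- The multiplication of the monad `𝒞 + 1`. -/
noncomputable def freeMult (O : Option (ConvSet (Option (ConvSet X)))) : Option (ConvSet X) :=
  joinM (Option.map (Option.map ConvSet.mult) (Option.map gammaFun O))

/-- The weighted Minkowski sum of the elements of `𝒞 X + 1`, weighted by `φ`; it is empty if `⋆`
has positive weight. -/
def minkowski (φ : Option (ConvSet X) →₀ ℝ) : Set (X →₀ ℝ) :=
  {ψ | ∃ χ : ConvSet X →₀ ℝ, Finsupp.mapDomain some χ = φ ∧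
    ∃ f : ConvSet X → (X →₀ ℝ), (∀ S, f S ∈ S.carrier) ∧ ψ = Finsupp.linearCombination ℝ f χ}

theorem mem_members_freeMult {O : Option (ConvSet (Option (ConvSet X)))} {ψ : X →₀ ℝ} :
    ψ ∈ members (freeMult O) ↔ ∃ φ ∈ members O, ψ ∈ minkowski φ := by
  cases O with
  | none =>
    refine iff_of_false not_memOpt_none ?_
    rintro ⟨φ, hφ, -⟩
    exact not_memOpt_none hφ
  | some S =>
    change MemOpt (Option.map ConvSet.mult (gammaFun S)) ψ ↔ _
    rw [memOpt_mult, members_some]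
    simp only [memOpt_gamma]
    constructor
    · rintro ⟨χ, hχ, h⟩
      exact ⟨_, hχ, χ, rfl, h⟩
    · rintro ⟨_, hφ, χ, rfl, h⟩
      exact ⟨χ, hφ, h⟩

theorem minkowski_single (o : Option (ConvSet X)) :
    minkowski (Finsupp.single o 1) = members o := by
  ext ψ
  constructor
  · rintro ⟨χ, hχ, f, hf, rfl⟩
    cases o with
    | none =>
      have h := mapDomain_some_none χ
      rw [hχ] at h
      simp at h
    | some S =>
      rw [← Finsupp.mapDomain_single] at hχ
      rw [Finsupp.mapDomain_injective (Option.some_injective _) hχ, members_some]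
      simpa using hf S
  · rintro ⟨S, rfl, hψ⟩
    obtain ⟨f, hf, e⟩ := S.exists_choice hψ
    exact ⟨Finsupp.single S 1, Finsupp.mapDomain_single, f, hf, by simp [e]⟩

/-- Weighted Minkowski sums are affine in the weights. -/
theorem minkowski_mix (p : Set.Ioo (0 : ℝ) 1) {φ φ' : Option (ConvSet X) →₀ ℝ}
    (hφ : ∀ o, 0 ≤ φ o) (hφ' : ∀ o, 0 ≤ φ' o) :
    minkowski (p.1 • φ + (1 - p.1) • φ') = p.1 • minkowski φ + (1 - p.1) • minkowski φ' := by
  have hp := p.2.1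
  have hp' : 0 < 1 - p.1 := (oneSub p).2.1
  ext ψ
  constructor
  · rintro ⟨χ, hχ, f, hf, rfl⟩
    have h0 := mapDomain_some_none χ
    rw [hχ] at h0
    have h0' : p.1 * φ none + (1 - p.1) * φ' none = 0 := by simpa using h0
    have h1 : φ none = 0 := by
      have := mul_nonneg hp'.le (hφ' none)
      nlinarith [mul_nonneg hp.le (hφ none), hφ none]
    have h2 : φ' none = 0 := by
      rw [h1, mul_zero, zero_add] at h0'
      exact (mul_eq_zero.1 h0').resolve_left hp'.ne'
    have e : χ = p.1 • φ.some + (1 - p.1) • φ'.some := by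
      rw [← some_mapDomain_some χ, hχ]
      ext S
      simp
    -- As `⋆` has no weight, both `φ` and `φ'` restrict to `𝒞 X`, with the same choice of elements.
    refine ⟨_, ⟨_, ⟨φ.some, eq_mapDomain_some h1, f, hf, rfl⟩, rfl⟩, _,
      ⟨_, ⟨φ'.some, eq_mapDomain_some h2, f, hf, rfl⟩, rfl⟩, ?_⟩
    rw [e, map_add, map_smul, map_smul]
  · rintro ⟨_, ⟨_, ⟨χ, rfl, f, hf, rfl⟩, rfl⟩, _, ⟨_, ⟨χ', rfl, f', hf', rfl⟩, rfl⟩, rfl⟩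
    have h1 : ∀ S, 0 ≤ χ S := fun S => by
      simpa [Finsupp.mapDomain_apply (Option.some_injective _)] using hφ (some S)
    have h2 : ∀ S, 0 ≤ χ' S := fun S => by
      simpa [Finsupp.mapDomain_apply (Option.some_injective _)] using hφ' (some S)
    -- The two choices of elements are merged into one, which the convexity of the sets permits.
    obtain ⟨g, hg, e⟩ := merge (fun S : ConvSet X => S.carrier) (fun S => S.convex)
      (fun S => S.nonempty) Finset.univ ![p.1 • χ, (1 - p.1) • χ']
      (by
        intro i _ S
        fin_cases i
        · exact mul_nonneg hp.le (h1 S)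
        · exact mul_nonneg hp'.le (h2 S))
      ![f, f']
      (by
        intro i _ S _
        fin_cases i
        · exact hf S
        · exact hf' S)
    refine ⟨p.1 • χ + (1 - p.1) • χ', ?_, g, hg, ?_⟩
    · rw [Finsupp.mapDomain_add, Finsupp.mapDomain_smul, Finsupp.mapDomain_smul]
    · simpa [Fin.sum_univ_two] using e.symm

/-- Barycentres in the free model are weighted Minkowski sums. -/
theorem members_barycentre {φ : Option (ConvSet X) →₀ ℝ} (hφ : φ ∈ probDist (Option (ConvSet X))) :
    members (barycentre φ) = minkowski φ := by
  refine probDist_induction (P := fun φ => members (barycentre φ) = minkowski φ) ?_ ?_ hφ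
  · intro o
    rw [barycentre_single, minkowski_single]
  · intro p φ ψ hφ hψ h1 h2
    rw [barycentre_mix p hφ hψ, members_mix, h1, h2, minkowski_mix p hφ.1 hψ.1]

/-- The multiplication of `𝒞 + 1` is the evaluation map of the free model. -/
theorem freeMult_eq_eval (O : Option (ConvSet (Option (ConvSet X)))) : freeMult O = eval O := by
  refine IsLUB.unique ⟨?_, fun u hu => ?_⟩ (isLUB_eval O)
  · rintro _ ⟨φ, hφ, rfl⟩
    rw [← members_subset_members, members_barycentre (members_subset O hφ)]
    exact fun ψ hψ => mem_members_freeMult.2 ⟨φ, hφ, hψ⟩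
  · rw [← members_subset_members]
    intro ψ hψ
    obtain ⟨φ, hφ, h⟩ := mem_members_freeMult.1 hψ
    rw [← members_barycentre (members_subset O hφ)] at h
    exact members_subset_members.2 (hu ⟨φ, hφ, rfl⟩) h

end Multiplication

/-! ### Eilenberg–Moore algebras as models -/

section FromAlgebras

open BotConvexSemilattice

variable {A B : Type u}

/-- The equations are inherited by quotients: operations on `A` that are compatible with those of
`B` along a surjection `B → A` satisfy them. -/
abbrev BotConvexSemilattice.ofSurjective [BotConvexSemilattice B] (q : B → A)
    (hq : Function.Surjective q) (op : A → A → A) (mx : Set.Ioo (0 : ℝ) 1 → A → A → A) (st : A)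
    (h_op : ∀ x y, op (q x) (q y) = q (oplus x y))
    (h_mx : ∀ p x y, mx p (q x) (q y) = q (BotConvexSemilattice.mix p x y)) (h_st : st = q star) :
    BotConvexSemilattice A where
  oplus := op
  mix := mx
  star := st
  oplus_assoc := hq.forall₃.2 fun x y z => by simp only [h_op, oplus_assoc]
  oplus_comm := hq.forall₂.2 fun x y => by simp only [h_op, oplus_comm x y]
  oplus_self := hq.forall.2 fun x => by simp only [h_op, oplus_self]
  mix_assoc p r := hq.forall₃.2 fun x y z => by simp only [h_mx, mix_assoc p r x y z]
  mix_comm p := hq.forall₂.2 fun x y => by simp only [h_mx, mix_comm p x y]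
  mix_self p := hq.forall.2 fun x => by simp only [h_mx, mix_self]
  mix_oplus p := hq.forall₃.2 fun x y z => by simp only [h_mx, h_op, mix_oplus]
  oplus_star := hq.forall.2 fun x => by simp only [h_st, h_op, oplus_star]
  mix_star p := hq.forall.2 fun x => by simp only [h_st, h_mx, mix_star]

theorem freeMap_id (o : Option (ConvSet A)) : freeMap id o = o := by
  rw [freeMap, funext ConvSet.map_id]
  exact congrFun Option.map_id o

theorem freeMap_freeMap {C : Type u} (f : A → B) (g : B → C) (o : Option (ConvSet A)) :
    freeMap g (freeMap f o) = freeMap (g ∘ f) o := by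
  rw [freeMap, freeMap, freeMap, Option.map_map, ← funext (ConvSet.map_map f g)]
  rfl

theorem isBotConvexHom_freeMult : IsBotConvexHom (freeMult (X := A)) := by
  rw [funext freeMult_eq_eval]
  exact isBotConvexHom_eval

theorem freeMult_freeUnit (o : Option (ConvSet A)) : freeMult (freeUnit o) = o := by
  rw [freeMult_eq_eval, eval_freeUnit]

/-- A map `𝒞 A + 1 → A` satisfying the laws of an Eilenberg–Moore algebra of `𝒞 + 1`. -/
structure IsMonadAlgebra (a : Option (ConvSet A) → A) : Prop where
  unit : ∀ x, a (freeUnit x) = x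
  assoc : ∀ O, a (freeMult O) = a (freeMap a O)

namespace IsMonadAlgebra

variable {a : Option (ConvSet A) → A} {b : Option (ConvSet B) → B}

/-- The operation `⊕` that `model` defines on `A` is compatible with that of the free model. -/
theorem map_sup (h : IsMonadAlgebra a) (o o' : Option (ConvSet A)) :
    a (freeUnit (a o) ⊔ freeUnit (a o')) = a (o ⊔ o') := by
  rw [← freeMap_freeUnit, ← freeMap_freeUnit, ← (isBotConvexHom_freeMap a).map_sup, ← h.assoc,
    isBotConvexHom_freeMult.map_sup, freeMult_freeUnit, freeMult_freeUnit]

/-- The operations `+_p` that `model` defines on `A` are compatible with those of the free model. -/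
theorem map_mix (h : IsMonadAlgebra a) (p : Set.Ioo (0 : ℝ) 1) (o o' : Option (ConvSet A)) :
    a (mix p (freeUnit (a o)) (freeUnit (a o'))) = a (mix p o o') := by
  rw [← freeMap_freeUnit, ← freeMap_freeUnit, ← (isBotConvexHom_freeMap a).map_mix, ← h.assoc,
    isBotConvexHom_freeMult.map_mix, freeMult_freeUnit, freeMult_freeUnit]

/-- The model structure of an Eilenberg–Moore algebra: an operation of the free model is applied to
the generators, and the result is evaluated. -/
noncomputable abbrev model (h : IsMonadAlgebra a) : BotConvexSemilattice A :=
  BotConvexSemilattice.ofSurjective a (fun x => ⟨_, h.unit x⟩)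
    (fun x y => a (freeUnit x ⊔ freeUnit y))
    (fun p x y => a (BotConvexSemilattice.mix p (freeUnit x) (freeUnit y))) (a ⊥)
    h.map_sup h.map_mix rfl

/-- The structure map is a homomorphism from the free model. -/
theorem isBotConvexHom (h : IsMonadAlgebra a) :
    letI := h.model
    IsBotConvexHom a :=
  letI := h.model
  { map_sup := fun o o' => (h.map_sup o o').symm
    map_mix := fun p o o' => (h.map_mix p o o').symm
    map_bot := rfl }

/-- The structure map of an Eilenberg–Moore algebra is determined by the operations: it is the
evaluation map of the associated model. -/
theorem eq_eval (h : IsMonadAlgebra a) :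
    letI := h.model
    a = eval := by
  let := h.model
  funext o
  have h1 : freeMult (freeMap freeUnit o) = o :=
    ConcreteCategory.congr_hom (convPlusOne.right_unit A) o
  have h2 : freeMap a (freeMap freeUnit o) = o := by
    have e : a ∘ freeUnit = id := funext h.unit
    rw [freeMap_freeMap, e, freeMap_id]
  -- Both sides are computed from the formal combination of generators `𝒞 η + 1` applied to `o`.
  calc a o = a (eval (freeMap freeUnit o)) := by rw [← freeMult_eq_eval, h1]
    _ = eval (freeMap a (freeMap freeUnit o)) := h.isBotConvexHom.map_eval _
    _ = eval o := by rw [h2]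

/-- Morphisms of Eilenberg–Moore algebras preserve the operations. -/
theorem isBotConvexHom_of_comm (ha : IsMonadAlgebra a) (hb : IsMonadAlgebra b) {f : A → B}
    (hf : ∀ o, b (freeMap f o) = f (a o)) :
    letI := ha.model
    letI := hb.model
    IsBotConvexHom f :=
  letI := ha.model
  letI := hb.model
  { map_sup := fun x y => by
      refine (hf _).symm.trans ?_
      rw [(isBotConvexHom_freeMap f).map_sup, freeMap_freeUnit, freeMap_freeUnit]
      rfl
    map_mix := fun p x y => by
      refine (hf _).symm.trans ?_
      rw [(isBotConvexHom_freeMap f).map_mix, freeMap_freeUnit, freeMap_freeUnit]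
      rfl
    map_bot := (hf _).symm }

end IsMonadAlgebra

theorem isMonadAlgebra_eval [BotConvexSemilattice A] : IsMonadAlgebra (eval (A := A)) where
  unit := eval_freeUnit
  assoc O := by rw [freeMult_eq_eval, isBotConvexHom_eval.map_eval]

theorem BotConvexSemilattice.ext_operations {s t : BotConvexSemilattice A}
    (h1 : ∀ x y, s.oplus x y = t.oplus x y) (h2 : ∀ p x y, s.mix p x y = t.mix p x y)
    (h3 : s.star = t.star) : s = t := by
  obtain ⟨op, mx, st⟩ := s
  obtain ⟨op', mx', st'⟩ := t
  obtain rfl : op = op' := funext₂ h1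
  obtain rfl : mx = mx' := funext₃ h2
  obtain rfl : st = st' := h3
  rfl

/-- The operations are recovered from the evaluation map. -/
theorem model_eval [s : BotConvexSemilattice A] : (isMonadAlgebra_eval (A := A)).model = s := by
  refine BotConvexSemilattice.ext_operations (fun x y => ?_) (fun p x y => ?_) ?_
  · refine (isBotConvexHom_eval.map_sup _ _).trans ?_
    rw [eval_freeUnit, eval_freeUnit]
    rfl
  · refine (isBotConvexHom_eval.map_mix _ _ _).trans ?_
    rw [eval_freeUnit, eval_freeUnit]
  · exact isBotConvexHom_eval.map_bot

end FromAlgebras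

/-! ### Models of the equational theory -/

section Models

open FirstOrder BotConvexSemilattice

theorem realize_plus {A : Type u} [sigma.Structure A] (s t : sigma.Term ℕ) (v : ℕ → A) :
    (plus s t).realize v =
      Language.Structure.funMap (L := sigma) Op.oplus ![s.realize v, t.realize v] := by
  refine (Language.Term.realize_func _ _ _).trans ?_
  congr 1
  funext i
  fin_cases i <;> rfl

theorem realize_pplus {A : Type u} [sigma.Structure A] (p : Set.Ioo (0 : ℝ) 1)
    (s t : sigma.Term ℕ) (v : ℕ → A) : (pplus p s t).realize v =
      Language.Structure.funMap (L := sigma) (Op.pplus p) ![s.realize v, t.realize v] := by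
  refine (Language.Term.realize_func _ _ _).trans ?_
  congr 1
  funext i
  fin_cases i <;> rfl

theorem realize_starTerm {A : Type u} [sigma.Structure A] (v : ℕ → A) :
    starTerm.realize v = Language.Structure.funMap (L := sigma) Op.star ![] := by
  refine (Language.Term.realize_func _ _ _).trans ?_
  congr 1
  funext i
  exact i.elim0

/-- The assignment of three values to the variables `x`, `y` and `z`. -/
def assign {A : Type u} (x y z : A) : ℕ → A
  | 0 => x
  | 1 => y
  | _ => z

theorem realize_assign {A : Type u} [sigma.Structure A] (x y z : A) :
    varX.realize (assign x y z) = x ∧ varY.realize (assign x y z) = y ∧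
      varZ.realize (assign x y z) = z := ⟨rfl, rfl, rfl⟩

/-- The operations of a model of the equations. -/
abbrev Alg.model (A : Alg.{u} bottomBlackHole) : BotConvexSemilattice A.carrier :=
  have hC : ∀ e, PointedConvexSemilattice e → ∀ v : ℕ → A.carrier,
      e.1.realize v = e.2.realize v := fun e he => A.sat e (Or.inl (Or.inl he))
  { oplus := fun x y => Language.Structure.funMap (L := sigma) Op.oplus ![x, y]
    mix := fun p x y => Language.Structure.funMap (L := sigma) (Op.pplus p) ![x, y]
    star := Language.Structure.funMap (L := sigma) Op.star ![]
    oplus_assoc := fun x y z => by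
      simpa [realize_plus, realize_assign] using hC _ .A (assign x y z)
    oplus_comm := fun x y => by
      simpa [realize_plus, realize_assign] using hC _ .C (assign x y x)
    oplus_self := fun x => by
      simpa [realize_plus, realize_assign] using hC _ .I (assign x x x)
    mix_assoc := fun p q x y z => by
      simpa [realize_pplus, realize_assign] using hC _ (.Ap p q) (assign x y z)
    mix_comm := fun p x y => by
      simpa [realize_pplus, realize_assign] using hC _ (.Cp p) (assign x y x)
    mix_self := fun p x => by
      simpa [realize_pplus, realize_assign] using hC _ (.Ip p) (assign x x x)
    mix_oplus := fun p x y z => by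
      simpa [realize_plus, realize_pplus, realize_assign] using hC _ (.D p) (assign x y z)
    oplus_star := fun x => by
      simpa [realize_plus, realize_starTerm, realize_assign] using
        A.sat _ (Or.inl (Or.inr rfl)) (assign x x x)
    mix_star := fun p x => by
      simpa [realize_pplus, realize_starTerm, realize_assign] using
        A.sat _ (Or.inr ⟨p, rfl⟩) (assign x x x) }

/-- The interpretation of the operation symbols in a convex semilattice with bottom and black
hole. -/
abbrev BotConvexSemilattice.toStructure {A : Type u} (s : BotConvexSemilattice A) :
    sigma.Structure A where
  funMap {n} o := match n, o with
    | _, Op.oplus => fun x => s.oplus (x 0) (x 1)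
    | _, Op.pplus p => fun x => s.mix p (x 0) (x 1)
    | _, Op.star => fun _ => s.star
  RelMap r := r.elim

/-- A convex semilattice with bottom and black hole as a model of the equations. -/
def BotConvexSemilattice.toAlg {A : Type u} (s : BotConvexSemilattice A) :
    Alg.{u} bottomBlackHole :=
  letI := s.toStructure
  { carrier := A
    sat := by
      rintro e ((he | rfl) | ⟨p, rfl⟩) v
      · cases he with
        | A => exact s.oplus_assoc (v 0) (v 1) (v 2)
        | C => exact s.oplus_comm (v 0) (v 1)
        | I => exact s.oplus_self (v 0)
        | Ap p q => exact s.mix_assoc p q (v 0) (v 1) (v 2)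
        | Cp p => exact s.mix_comm p (v 0) (v 1)
        | Ip p => exact s.mix_self p (v 0)
        | D p => exact s.mix_oplus p (v 0) (v 1) (v 2)
      · exact s.oplus_star (v 0)
      · exact s.mix_star p (v 0) }

theorem Alg.mk_congr {L : Language} {E : Set (Equation L)} {A : Type u} {s t : L.Structure A}
    (h : s = t) (hs ht) : @Alg.mk L E A s hs = @Alg.mk L E A t ht := by
  subst h
  rfl

theorem vec_two_eta {A : Type u} (x : Fin 2 → A) : ![x 0, x 1] = x := by
  funext i
  fin_cases i <;> rfl

theorem toAlg_model (A : Alg.{u} bottomBlackHole) : A.model.toAlg = A := by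
  refine Alg.mk_congr (Language.Structure.ext ?_ ?_) _ A.sat
  · funext n o x
    cases o with
    | oplus => exact congrArg (A.str.funMap Op.oplus) (vec_two_eta x)
    | pplus p => exact congrArg (A.str.funMap (Op.pplus p)) (vec_two_eta x)
    | star => exact congrArg (A.str.funMap Op.star) (Subsingleton.elim _ _)
  · funext n r
    exact r.elim

theorem isBotConvexHom_toFun {A B : Alg.{u} bottomBlackHole} (f : A ⟶ B) :
    letI := A.model
    letI := B.model
    IsBotConvexHom (Language.Hom.toFun f) := by
  have h : ∀ {n} (o : sigma.Functions n) (x : Fin n → A.carrier), Language.Hom.toFun f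
      (Language.Structure.funMap o x) = Language.Structure.funMap o (Language.Hom.toFun f ∘ x) :=
    fun o x => Language.Hom.map_fun' f o x
  refine @IsBotConvexHom.mk _ _ A.model B.model _ (fun x y => ?_) (fun p x y => ?_) ?_
  · refine (h (n := 2) Op.oplus ![x, y]).trans ?_
    rw [← vec_two_eta (_ ∘ _)]
    rfl
  · refine (h (n := 2) (Op.pplus p) ![x, y]).trans ?_
    rw [← vec_two_eta (_ ∘ _)]
    rfl
  · refine (h (n := 0) Op.star ![]).trans ?_
    exact congrArg (B.str.funMap Op.star) (Subsingleton.elim _ _)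

/-- A homomorphism of convex semilattices with bottom and black hole as a morphism of models. -/
def IsBotConvexHom.toHom {A B : Type u} {s : BotConvexSemilattice A} {t : BotConvexSemilattice B}
    {f : A → B} (hf : IsBotConvexHom f) : s.toAlg ⟶ t.toAlg :=
  letI := s.toStructure
  letI := t.toStructure
  show sigma.Hom A B from
  { toFun := f
    map_fun' := by
      rintro n o x
      cases o with
      | oplus => exact hf.map_sup _ _
      | pplus p => exact hf.map_mix p _ _
      | star => exact hf.map_bot
    map_rel' := fun r => r.elim }

end Models

/-! ### The isomorphism of categories -/

section Isomorphism

open FirstOrder BotConvexSemilattice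

/-- The laws of an Eilenberg–Moore algebra of `𝒞 + 1`, in terms of elements. -/
theorem isMonadAlgebra_algebra (A : Monad.Algebra convPlusOne.{u}) : IsMonadAlgebra ⇑A.a where
  unit x := ConcreteCategory.congr_hom A.unit x
  assoc O := ConcreteCategory.congr_hom A.assoc O

/-- The Eilenberg–Moore algebra of a convex semilattice with bottom and black hole. -/
noncomputable def BotConvexSemilattice.toAlgebra {A : Type u} (s : BotConvexSemilattice A) :
    Monad.Algebra convPlusOne.{u} where
  A := A
  a := ↾(eval (A := A))
  unit := ConcreteCategory.hom_ext _ _ fun x => (isMonadAlgebra_eval (A := A)).unit x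
  assoc := ConcreteCategory.hom_ext _ _ fun O => (isMonadAlgebra_eval (A := A)).assoc O

/-- Every Eilenberg–Moore algebra of `𝒞 + 1` is a model. -/
noncomputable def algebraToModel :
    Monad.Algebra convPlusOne.{u} ⥤ Alg.{u} bottomBlackHole where
  obj A := (isMonadAlgebra_algebra A).model.toAlg
  map {A B} f := ((isMonadAlgebra_algebra A).isBotConvexHom_of_comm (isMonadAlgebra_algebra B)
    (f := ⇑f.f) fun o => ConcreteCategory.congr_hom f.h o).toHom
  map_id _ := rfl
  map_comp _ _ := rfl

/-- Every model is an Eilenberg–Moore algebra of `𝒞 + 1`. -/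
noncomputable def modelToAlgebra :
    Alg.{u} bottomBlackHole ⥤ Monad.Algebra convPlusOne.{u} where
  obj A := A.model.toAlgebra
  map {A B} f :=
    { f := (↾(Language.Hom.toFun f : A.carrier → B.carrier) :)
      h := ConcreteCategory.hom_ext _ _ fun o =>
        letI := A.model
        letI := B.model
        ((isBotConvexHom_toFun f).map_eval o).symm }
  map_id _ := rfl
  map_comp _ _ := rfl

/-- Morphisms between propositionally equal algebras agree if their underlying maps do. -/
theorem algebra_hom_heq {A A' B B' : Monad.Algebra convPlusOne.{u}} (hA : A = A') (hB : B = B')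
    {f : A ⟶ B} {g : A' ⟶ B'} (h : HEq f.f g.f) : HEq f g := by
  subst hA hB
  exact heq_of_eq (Monad.Algebra.Hom.ext (eq_of_heq h))

/-- Homomorphisms between propositionally equal models agree if their underlying maps do. -/
theorem alg_hom_heq {A A' B B' : Alg.{u} bottomBlackHole} (hA : A = A') (hB : B = B')
    {f : A ⟶ B} {g : A' ⟶ B'} (h : HEq (Language.Hom.toFun f) (Language.Hom.toFun g)) :
    HEq f g := by
  subst hA hB
  exact heq_of_eq (Language.Hom.ext fun x => congrFun (eq_of_heq h) x)

theorem algebra_ext {A : Type u} {a b : (convPlusOne.{u} : Type u ⥤ Type u).obj A ⟶ A} (h : a = b)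
    {ha ha' hb hb'} : (⟨A, a, ha, ha'⟩ : Monad.Algebra convPlusOne.{u}) = ⟨A, b, hb, hb'⟩ := by
  subst h
  rfl

theorem toAlgebra_model (A : Monad.Algebra convPlusOne.{u}) :
    (isMonadAlgebra_algebra A).model.toAlgebra = A := by
  have h : (isMonadAlgebra_algebra A).model.toAlgebra.a = A.a :=
    ConcreteCategory.hom_ext _ _ fun o => (congrFun (isMonadAlgebra_algebra A).eq_eval o).symm
  exact algebra_ext h

theorem algebraToModel_comp_modelToAlgebra :
    algebraToModel.{u} ⋙ modelToAlgebra = 𝟭 (Monad.Algebra convPlusOne.{u}) :=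
  CategoryTheory.Functor.hext toAlgebra_model fun A B _ =>
    algebra_hom_heq (toAlgebra_model A) (toAlgebra_model B) HEq.rfl

theorem toAlg_model_toAlgebra (A : Alg.{u} bottomBlackHole) :
    (isMonadAlgebra_algebra A.model.toAlgebra).model.toAlg = A :=
  (congrArg BotConvexSemilattice.toAlg (@model_eval _ A.model)).trans (toAlg_model A)

theorem modelToAlgebra_comp_algebraToModel :
    modelToAlgebra.{u} ⋙ algebraToModel = 𝟭 (Alg.{u} bottomBlackHole) :=
  CategoryTheory.Functor.hext toAlg_model_toAlgebra fun A B _ =>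
    alg_hom_heq (toAlg_model_toAlgebra A) (toAlg_model_toAlgebra B) HEq.rfl

end Isomorphism

end ConvexMonad

theorem mainTheorem1 :
    ∃ (P : CategoryTheory.Monad.Algebra ConvexMonad.convPlusOne.{u} ⥤
          ConvexMonad.Alg.{u} ConvexMonad.bottomBlackHole)
      (Q : ConvexMonad.Alg.{u} ConvexMonad.bottomBlackHole ⥤
          CategoryTheory.Monad.Algebra ConvexMonad.convPlusOne.{u}),
      P ⋙ Q = 𝟭 _ ∧ Q ⋙ P = 𝟭 _ ∧
      P ⋙ ConvexMonad.Alg.forget ConvexMonad.bottomBlackHole =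
        CategoryTheory.Monad.forget ConvexMonad.convPlusOne.{u} :=
  ⟨ConvexMonad.algebraToModel, ConvexMonad.modelToAlgebra,
    ConvexMonad.algebraToModel_comp_modelToAlgebra,
    ConvexMonad.modelToAlgebra_comp_algebraToModel, rfl⟩
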